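/- A smooth real germ $f$ at $P\in\mathbb R^4$ is called $k$-determined if every smooth germ $g$ at $P$ with the same $k$-jet at $P$ has the form $g=f\circ\varphi$ near $P$, where $\varphi$ is the germ of a diffeomorphism with $\varphi(P)=P$. Let $V(x,y,z,w)$ be a real function, smooth near a critical point $P_0\in\mathbb R^4$, and let $\mathbb H$ be its Hessian matrix at $P_0$. Then $V$ is not 2-determined at $P_0$ if and only if $\det\mathbb H=0$. Assume moreover that $V_{zz}\neq0$ and that one of the following holds: $V$ has a corank-1 singularity at $P_0$ (the kernel of $\mathbb H$ is one-dimensional) whose null eigenvector has the form $(0,0,v_3,v_4)$; or $\mathbb H$ is positive definite (a nondegenerate minimum). With all derivatives evaluated at $P_0$ put $\alpha=V_{zw}/V_{zz}$ and $$\mathrm D^2V=\alpha^2V_{zz}-2\alpha V_{zw}+V_{ww},\qquad \mathrm D^3V=\alpha^3V_{zzz}-3\alpha^2V_{zzw}+3\alpha V_{zww}-V_{www},$$ $$\mathrm D^4V=\alpha^4V_{zzzz}-4\alpha^3V_{zzzw}+6\alpha^2V_{zzww}-4\alpha V_{zwww}+V_{wwww},$$ $$\kappa_1=\alpha^2V_{xzz}-2\alpha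 V_{xzw}+V_{xww},\quad \kappa_2=\alpha^2V_{yzz}-2\alpha V_{yzw}+V_{yww},\quad \kappa_3=\alpha^2V_{zzz}-2\alpha V_{zzw}+V_{zww}.$$ Let $\mathrm M$ be the determinant of the upper-left $3\times3$ block of $\mathbb H$ (variables $x,y,z$), let $\mathrm M_{ij}$ be the $(i,j)$-minor of that block (the determinant left after removing row $i$ and column $j$), and let $\mathbb H_2$ be the lower-right $2\times2$ block of $\mathbb H$ (variables $z,w$). Then: 0. $\det\mathbb H=0$ if and only if $\det\mathbb H_2=0$. 1. $V$ is not 2-determined at $P_0$ if and only if $\mathrm D^2V=0$. 2. $V$ is not 3-determined at $P_0$ if and only if $\mathrm D^2V=0$ and $\mathrm D^3V=0$. 3. $V$ is not 4-determined at $P_0$ if and only if $\mathrm D^2V=0$, $\mathrm D^3V=0$ and $$\mathrm M\,\mathrm D^4V-3\sum_{i,j=1}^3(-1)^{i+j}\,\mathrm M_{ij}\,\kappa_i\kappa_j=0.$$ -/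

import Mathlib

open Filter Topology
open scoped ContDiff

noncomputable section

namespace Determinacy

section Germs

variable {E : Type*} [NormedAddCommGroup E] [NormedSpace ℝ E]
  {F : Type*} [NormedAddCommGroup F] [NormedSpace ℝ F]

/-- `f` is smooth on a neighbourhood of `p`, that is, `f` represents a smooth germ at `p`. -/
def IsSmoothGerm (f : E → F) (p : E) : Prop :=
  ∀ᶠ x in 𝓝 p, ContDiffAt ℝ ∞ f x

/-- The `k`-jets of `f` and `g` at `p` agree: all derivatives of order at most `k`
(the values included) coincide at `p`. -/
def SameJet (k : ℕ) (f g : E → ℝ) (p : E) : Prop :=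
  ∀ m ≤ k, iteratedFDeriv ℝ m f p = iteratedFDeriv ℝ m g p

/-- The germs of `f` and `g` at `p` are diffeomorphic: `g = f ∘ φ` near `p` for the germ `φ` of a
diffeomorphism fixing `p` (with inverse germ `ψ`). -/
def DiffeomorphicGerms (f g : E → ℝ) (p : E) : Prop :=
  ∃ φ ψ : E → E, IsSmoothGerm φ p ∧ IsSmoothGerm ψ p ∧ φ p = p ∧ ψ p = p ∧
    (∀ᶠ x in 𝓝 p, ψ (φ x) = x) ∧ (∀ᶠ x in 𝓝 p, φ (ψ x) = x) ∧
    ∀ᶠ x in 𝓝 p, g x = f (φ x)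

/-- The germ of `f` at `p` is `k`-determined: every smooth germ with the same `k`-jet at `p` is
diffeomorphic to it. -/
def IsDetermined (k : ℕ) (f : E → ℝ) (p : E) : Prop :=
  ∀ g : E → ℝ, IsSmoothGerm g p → SameJet k f g p → DiffeomorphicGerms f g p

end Germs

/-- The partial derivative with respect to the `i`-th coordinate of `ℝ⁴`. The coordinates
`x, y, z, w` have the indices `0, 1, 2, 3`. -/
def pd (i : Fin 4) (f : (Fin 4 → ℝ) → ℝ) : (Fin 4 → ℝ) → ℝ :=
  fun p => fderiv ℝ f p (Pi.single i 1)

section Coefficients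

variable (V : (Fin 4 → ℝ) → ℝ) (p : Fin 4 → ℝ)

/-- The Hessian matrix of `V` at `p`. -/
def hessian : Matrix (Fin 4) (Fin 4) ℝ :=
  Matrix.of fun i j => pd i (pd j V) p

/-- The lower right `2 × 2` block of the Hessian (variables `z, w`). -/
def hessianZW : Matrix (Fin 2) (Fin 2) ℝ :=
  (hessian V p).submatrix ![2, 3] ![2, 3]

/-- The upper left `3 × 3` block of the Hessian (variables `x, y, z`). -/
def hessianXYZ : Matrix (Fin 3) (Fin 3) ℝ :=
  (hessian V p).submatrix Fin.castSucc Fin.castSucc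

/-- The `(i, j)`-minor of `hessianXYZ`: row `i` and column `j` are removed. -/
def minorXYZ (i j : Fin 3) : ℝ :=
  ((hessianXYZ V p).submatrix i.succAbove j.succAbove).det

/-- `α = V_zw / V_zz`. -/
def α : ℝ := pd 2 (pd 3 V) p / pd 2 (pd 2 V) p

/-- `D²V = α² V_zz - 2 α V_zw + V_ww`. -/
def D2 : ℝ :=
  α V p ^ 2 * pd 2 (pd 2 V) p - 2 * α V p * pd 2 (pd 3 V) p + pd 3 (pd 3 V) p

/-- `D³V = α³ V_zzz - 3 α² V_zzw + 3 α V_zww - V_www`. -/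
def D3 : ℝ :=
  α V p ^ 3 * pd 2 (pd 2 (pd 2 V)) p - 3 * α V p ^ 2 * pd 2 (pd 2 (pd 3 V)) p
    + 3 * α V p * pd 2 (pd 3 (pd 3 V)) p - pd 3 (pd 3 (pd 3 V)) p

/-- `D⁴V = α⁴ V_zzzz - 4 α³ V_zzzw + 6 α² V_zzww - 4 α V_zwww + V_wwww`. -/
def D4 : ℝ :=
  α V p ^ 4 * pd 2 (pd 2 (pd 2 (pd 2 V))) p - 4 * α V p ^ 3 * pd 2 (pd 2 (pd 2 (pd 3 V))) p
    + 6 * α V p ^ 2 * pd 2 (pd 2 (pd 3 (pd 3 V))) p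
    - 4 * α V p * pd 2 (pd 3 (pd 3 (pd 3 V))) p + pd 3 (pd 3 (pd 3 (pd 3 V))) p

/-- `κ_u = α² V_uzz - 2 α V_uzw + V_uww` for `u` one of `x, y, z`. -/
def κ (u : Fin 3) : ℝ :=
  α V p ^ 2 * pd u.castSucc (pd 2 (pd 2 V)) p - 2 * α V p * pd u.castSucc (pd 2 (pd 3 V)) p
    + pd u.castSucc (pd 3 (pd 3 V)) p

/-- `M D⁴V - 3 ∑ (-1)^(i+j) M_ij κ_i κ_j`, where `M` is the determinant of `hessianXYZ` and `M_ij`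
are its minors. -/
def quarticForm : ℝ :=
  (hessianXYZ V p).det * D4 V p
    - 3 * ∑ i : Fin 3, ∑ j : Fin 3,
        (-1) ^ ((i : ℕ) + (j : ℕ)) * minorXYZ V p i j * κ V p i * κ V p j

/-- The Hessian at `p` has corank one, and its null eigenvector has the form `(0, 0, v₃, v₄)`. -/
def HasCorankOneZW : Prop :=
  Module.finrank ℝ (LinearMap.ker (hessian V p).mulVecLin) = 1 ∧
    ∃ v₃ v₄ : ℝ, ¬(v₃ = 0 ∧ v₄ = 0) ∧ (hessian V p).mulVec ![0, 0, v₃, v₄] = 0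

end Coefficients

end Determinacy

end

/-! Determinacy is reduced to the Taylor coefficients of a function of one variable. If the Hessian
is invertible, the Morse lemma (`germEquiv_of_nondegenerate`) brings the germ to its value plus half
its Hessian form. Both are read off the 2-jet, so the germ is 2-determined and a fortiori 3- and
4-determined. This settles the positive definite case.

In the corank-1 case the kernel is spanned by `v = (0, 0, -α, 1)`, and the Hessian is nondegenerate
on the `x, y, z` directions. The splitting lemma makes `V` equivalent to `r(t) + A(w, w) / 2`, where
`r(t)` is the value of `V` at the critical point of its restriction to the fibre over `t`. To
compute `r`, the curve of these critical points is replaced by the parabola `P + t v - (t² / 2) a`,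
with `a` solving `(hessianXYZ V P) a = κ`. Along it the fibre derivative is `O(t³)`, so the error in
`r`, quadratic in that derivative, is `O(t⁶)`. Hence `r` has cubic coefficient `-D³V / 6` and
quartic coefficient `quarticForm / (24 M)`, the sum over minors being `M` times `a · κ`.

If the first nonzero coefficient of `r` has order `k`, with `3 ≤ k ≤ 5`, the substitution `t ↦ t
u(t)^(1/k)` gives a normal form depending only on the `k`-jet, so `V` is `k`-determined. Failure of
determinacy is detected by an invariant: whether the critical point is isolated. A degenerate
`k`-jet is completed in two ways, once with a line of critical points and once with an isolated one;
the two completions cannot both be equivalent to `V`. -/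

namespace Determinacy

/-! ### Smooth dependence of integrals on parameters -/

section Integral

universe u

theorem hasFDerivAt_integral_of_contDiff {E Y : Type u} [NormedAddCommGroup E] [NormedSpace ℝ E]
    [FiniteDimensional ℝ E] [NormedAddCommGroup Y] [NormedSpace ℝ Y] [CompleteSpace Y]
    {G : E × ℝ → Y} (hG : ContDiff ℝ ∞ G) (x₀ : E) :
    HasFDerivAt (fun x => ∫ s in (0 : ℝ)..1, G (x, s))
      (∫ s in (0 : ℝ)..1, (fderiv ℝ G (x₀, s)).comp (ContinuousLinearMap.inl ℝ E ℝ)) x₀ := by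
  have hG' : Continuous fun q : E × ℝ =>
      (fderiv ℝ G q).comp (ContinuousLinearMap.inl ℝ E ℝ) :=
    (hG.continuous_fderiv (by simp)).clm_comp continuous_const
  have hK : IsCompact (Metric.closedBall x₀ 1 ×ˢ Set.uIcc (0 : ℝ) 1) :=
    (isCompact_closedBall x₀ 1).prod isCompact_uIcc
  obtain ⟨C, hC⟩ := hK.exists_bound_of_continuousOn hG'.continuousOn
  refine intervalIntegral.hasFDerivAt_integral_of_dominated_of_fderiv_le (𝕜 := ℝ)
    (s := Metric.ball x₀ 1) (bound := fun _ => C)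
    (F := fun x s => G (x, s))
    (F' := fun x s => (fderiv ℝ G (x, s)).comp (ContinuousLinearMap.inl ℝ E ℝ))
    (Metric.ball_mem_nhds x₀ one_pos) ?_ ?_ ?_ ?_ ?_ ?_
  · exact Eventually.of_forall fun x =>
      (hG.continuous.comp (by fun_prop : Continuous fun s : ℝ => (x, s))).aestronglyMeasurable
  · exact (hG.continuous.comp (by fun_prop : Continuous fun s : ℝ => (x₀, s))).intervalIntegrable _ _
  · exact (hG'.comp (by fun_prop : Continuous fun s : ℝ => (x₀, s))).aestronglyMeasurable
  · refine Eventually.of_forall fun s hs x hx => hC (x, s) ⟨Metric.ball_subset_closedBall hx, ?_⟩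
    exact Set.uIoc_subset_uIcc hs
  · exact intervalIntegrable_const
  · refine Eventually.of_forall fun s _ x _ => ?_
    exact ((hG.differentiable (by simp)) (x, s)).hasFDerivAt.comp x (hasFDerivAt_prodMk_left x s)

/-- Induction on the order of differentiability, with the target space varying: the derivative is
again such an integral, with values in `E →L[ℝ] Y`. Taking `E` and `Y` in one universe keeps this
new target in the range of the induction. -/
theorem contDiff_nat_integral {E : Type u} [NormedAddCommGroup E] [NormedSpace ℝ E]
    [FiniteDimensional ℝ E] (n : ℕ) : ∀ {Y : Type u} [NormedAddCommGroup Y] [NormedSpace ℝ Y]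
    [CompleteSpace Y] {G : E × ℝ → Y}, ContDiff ℝ ∞ G →
    ContDiff ℝ n (fun x => ∫ s in (0 : ℝ)..1, G (x, s)) := by
  induction n with
  | zero =>
    intro Y _ _ _ G hG
    exact contDiff_zero.2 (intervalIntegral.continuous_parametric_intervalIntegral_of_continuous'
      (f := fun x s => G (x, s)) hG.continuous 0 1)
  | succ n ih =>
    intro Y _ _ _ G hG
    refine (contDiff_succ_iff_hasFDerivAt (n := n)).2
      ⟨_, ih (G := fun q => (fderiv ℝ G q).comp (ContinuousLinearMap.inl ℝ E ℝ)) ?_,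
        fun x => hasFDerivAt_integral_of_contDiff hG x⟩
    exact (hG.fderiv_right (m := ∞) (by simp)).clm_comp contDiff_const

theorem contDiff_integral {E Y : Type u} [NormedAddCommGroup E] [NormedSpace ℝ E]
    [FiniteDimensional ℝ E] [NormedAddCommGroup Y] [NormedSpace ℝ Y] [CompleteSpace Y]
    {G : E × ℝ → Y} (hG : ContDiff ℝ ∞ G) :
    ContDiff ℝ ∞ (fun x => ∫ s in (0 : ℝ)..1, G (x, s)) :=
  contDiff_infty.2 fun n => contDiff_nat_integral n hG

end Integral

/-! ### Extension of germs and Hadamard's lemma -/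

section Hadamard

universe u
variable {E : Type*} [NormedAddCommGroup E] [NormedSpace ℝ E]
  {Y : Type*} [NormedAddCommGroup Y] [NormedSpace ℝ Y]

theorem IsSmoothGerm.contDiffAt {f : E → Y} {p : E} (hf : IsSmoothGerm f p) :
    ContDiffAt ℝ ∞ f p := Eventually.self_of_nhds hf

/-- A bump function cuts the germ off. With a globally smooth representative, integrals along
segments need no control of the domain. -/
theorem IsSmoothGerm.exists_contDiff [FiniteDimensional ℝ E] {f : E → Y} {p : E}
    (hf : IsSmoothGerm f p) : ∃ g : E → Y, ContDiff ℝ ∞ g ∧ g =ᶠ[𝓝 p] f := by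
  obtain ⟨ε, hε, hball⟩ := Metric.eventually_nhds_iff_ball.1 hf
  let χ : ContDiffBump p := ⟨ε / 4, ε / 2, by positivity, by linarith⟩
  refine ⟨fun x => χ x • f x, contDiff_iff_contDiffAt.2 fun x => ?_, ?_⟩
  · by_cases hx : x ∈ Metric.ball p ε
    · exact χ.contDiff.contDiffAt.smul (hball x hx)
    · have hx' : x ∈ (Metric.closedBall p (ε / 2))ᶜ := by
        simp only [Metric.mem_ball, not_lt, Set.mem_compl_iff, Metric.mem_closedBall, not_le] at hx ⊢
        linarith
      have : (fun x => χ x • f x) =ᶠ[𝓝 x] fun _ => 0 := by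
        filter_upwards [Metric.isClosed_closedBall.isOpen_compl.mem_nhds hx'] with y hy
        simp only [Set.mem_compl_iff, Metric.mem_closedBall, not_le] at hy
        rw [χ.zero_of_le_dist (x := y) (show χ.rOut ≤ _ from hy.le), zero_smul]
      exact contDiffAt_const.congr_of_eventuallyEq this
  · filter_upwards [χ.eventuallyEq_one] with x hx
    simp [hx]

/-- Hadamard's lemma with parameters. -/
theorem IsSmoothGerm.hadamard {W T Y : Type u} [NormedAddCommGroup W] [NormedSpace ℝ W]
    [FiniteDimensional ℝ W] [NormedAddCommGroup T] [NormedSpace ℝ T] [FiniteDimensional ℝ T]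
    [NormedAddCommGroup Y] [NormedSpace ℝ Y] [CompleteSpace Y] {f : W × T → Y}
    (hf : IsSmoothGerm f 0) : ∃ B : W × T → W →L[ℝ] Y, IsSmoothGerm B 0 ∧
      ∀ᶠ p in 𝓝 (0 : W × T), f p = f (0, p.2) + B p p.1 := by
  obtain ⟨g, hg, hgf⟩ := hf.exists_contDiff
  let G : (W × T) × ℝ → W →L[ℝ] Y := fun q =>
    (fderiv ℝ g (q.2 • q.1.1, q.1.2)).comp (ContinuousLinearMap.inl ℝ W T)
  have hG : ContDiff ℝ ∞ G := by
    refine ContDiff.clm_comp ?_ contDiff_const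
    exact (hg.fderiv_right (m := ∞) (by simp)).comp (by fun_prop)
  refine ⟨fun p => ∫ s in (0 : ℝ)..1, G (p, s),
    Eventually.of_forall fun x => (contDiff_integral hG).contDiffAt, ?_⟩
  have h0 : Tendsto (fun p : W × T => ((0 : W), p.2)) (𝓝 0) (𝓝 0) := by
    have : Continuous fun p : W × T => ((0 : W), p.2) := by fun_prop
    exact this.tendsto' _ _ rfl
  filter_upwards [hgf, h0.eventually hgf] with p hp hp0
  rw [← hp, ← hp0]
  have hi : IntervalIntegrable (fun s => G (p, s)) MeasureTheory.volume 0 1 :=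
    (hG.continuous.comp (by fun_prop : Continuous fun s : ℝ => (p, s))).intervalIntegrable _ _
  rw [ContinuousLinearMap.intervalIntegral_apply hi]
  have hd : ∀ s ∈ Set.uIcc (0 : ℝ) 1,
      HasDerivAt (fun s : ℝ => g (s • p.1, p.2)) (G (p, s) p.1) s := by
    intro s _
    have h1 : HasDerivAt (fun s : ℝ => (s • p.1, p.2)) (p.1, 0) s := by
      have := (hasDerivAt_id s).smul_const p.1
      simpa using this.prodMk (hasDerivAt_const s p.2)
    simpa [G, Function.comp_def] using
      ((hg.differentiable (by simp)) (s • p.1, p.2)).hasFDerivAt.comp_hasDerivAt s h1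
  rw [intervalIntegral.integral_eq_sub_of_hasDerivAt hd]
  · simp
  · exact ((hG.continuous.comp (by fun_prop : Continuous fun s : ℝ => (p, s))).clm_apply
      continuous_const).intervalIntegrable _ _

end Hadamard

/-! ### Calculus of smooth germs and the inverse function theorem -/

section Calculus

variable {E : Type*} [NormedAddCommGroup E] [NormedSpace ℝ E]
  {F : Type*} [NormedAddCommGroup F] [NormedSpace ℝ F]
  {Y : Type*} [NormedAddCommGroup Y] [NormedSpace ℝ Y]

theorem IsSmoothGerm.comp {f : F → Y} {g : E → F} {p : E} (hf : IsSmoothGerm f (g p))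
    (hg : IsSmoothGerm g p) : IsSmoothGerm (fun x => f (g x)) p := by
  filter_upwards [hg, hg.contDiffAt.continuousAt.eventually hf] with x h1 h2
  exact h2.comp x h1

theorem IsSmoothGerm.comp_of_eq {f : F → Y} {g : E → F} {p : E} {q : F} (hf : IsSmoothGerm f q)
    (hg : IsSmoothGerm g p) (h : g p = q) : IsSmoothGerm (fun x => f (g x)) p :=
  IsSmoothGerm.comp (h ▸ hf) hg

theorem IsSmoothGerm.of_contDiff {f : E → Y} (hf : ContDiff ℝ ∞ f) (p : E) : IsSmoothGerm f p :=
  Eventually.of_forall fun _ => hf.contDiffAt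

theorem IsSmoothGerm.fderiv_right {f : E → Y} {p : E} (hf : IsSmoothGerm f p) :
    IsSmoothGerm (fderiv ℝ f) p := by
  filter_upwards [hf] with x h
  exact h.fderiv_right (by simp)

theorem IsSmoothGerm.eventually_differentiableAt {f : E → Y} {p : E} (hf : IsSmoothGerm f p) :
    ∀ᶠ x in 𝓝 p, DifferentiableAt ℝ f x := by
  filter_upwards [hf] with x h
  exact h.differentiableAt (by simp)

theorem IsSmoothGerm.differentiableAt {f : E → Y} {p : E} (hf : IsSmoothGerm f p) :
    DifferentiableAt ℝ f p := hf.contDiffAt.differentiableAt (by simp)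

theorem IsSmoothGerm.prodMk {f : E → F} {g : E → Y} {p : E} (hf : IsSmoothGerm f p)
    (hg : IsSmoothGerm g p) : IsSmoothGerm (fun x => (f x, g x)) p := by
  filter_upwards [hf, hg] with x h1 h2
  exact h1.prodMk h2

theorem IsSmoothGerm.add {f g : E → Y} {p : E} (hf : IsSmoothGerm f p)
    (hg : IsSmoothGerm g p) : IsSmoothGerm (fun x => f x + g x) p := by
  filter_upwards [hf, hg] with x h1 h2
  exact h1.add h2

theorem IsSmoothGerm.sub {f g : E → Y} {p : E} (hf : IsSmoothGerm f p)
    (hg : IsSmoothGerm g p) : IsSmoothGerm (fun x => f x - g x) p := by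
  filter_upwards [hf, hg] with x h1 h2
  exact h1.sub h2

theorem IsSmoothGerm.smul {f : E → ℝ} {g : E → Y} {p : E} (hf : IsSmoothGerm f p)
    (hg : IsSmoothGerm g p) : IsSmoothGerm (fun x => f x • g x) p := by
  filter_upwards [hf, hg] with x h1 h2
  exact h1.smul h2

theorem IsSmoothGerm.clm_apply {f : E → F →L[ℝ] Y} {g : E → F} {p : E} (hf : IsSmoothGerm f p)
    (hg : IsSmoothGerm g p) : IsSmoothGerm (fun x => f x (g x)) p := by
  filter_upwards [hf, hg] with x h1 h2
  exact h1.clm_apply h2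

theorem IsSmoothGerm.exists_eq_add_smul {Y : Type} [NormedAddCommGroup Y] [NormedSpace ℝ Y]
    [CompleteSpace Y] {σ : ℝ → Y} (hσ : IsSmoothGerm σ 0) :
    ∃ h : ℝ → Y, IsSmoothGerm h 0 ∧ ∀ᶠ t in 𝓝 (0 : ℝ), σ t = σ 0 + t • h t := by
  have hF : IsSmoothGerm (fun q : ℝ × ℝ => σ q.1) 0 :=
    hσ.comp_of_eq (.of_contDiff contDiff_fst _) rfl
  obtain ⟨B, hB, hFB⟩ := hF.hadamard
  have hi : IsSmoothGerm (fun t : ℝ => (t, (0 : ℝ))) 0 := .of_contDiff (by fun_prop) _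
  refine ⟨fun t => B (t, 0) 1,
    (hB.comp_of_eq hi rfl).clm_apply (.of_contDiff contDiff_const _), ?_⟩
  have h0 : Tendsto (fun t : ℝ => (t, (0 : ℝ))) (𝓝 0) (𝓝 0) :=
    (by fun_prop : Continuous fun t : ℝ => (t, (0 : ℝ))).tendsto' _ _ rfl
  filter_upwards [h0.eventually hFB] with t ht
  rw [ht, ← map_smul, smul_eq_mul, mul_one]

/-- The inverse function theorem for smooth germs. -/
theorem IsSmoothGerm.exists_inverse [CompleteSpace E] {φ : E → F} {p : E}
    (hφ : IsSmoothGerm φ p) {e : E ≃L[ℝ] F} (he : HasFDerivAt φ (e : E →L[ℝ] F) p) :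
    ∃ ψ : F → E, IsSmoothGerm ψ (φ p) ∧ ψ (φ p) = p ∧ (∀ᶠ x in 𝓝 p, ψ (φ x) = x) ∧
      ∀ᶠ y in 𝓝 (φ p), φ (ψ y) = y := by
  have hne : (∞ : ℕ∞ω) ≠ 0 := by simp
  let Φ := hφ.contDiffAt.toOpenPartialHomeomorph φ he hne
  have hp : p ∈ Φ.source := hφ.contDiffAt.mem_toOpenPartialHomeomorph_source he hne
  have hΦ : ∀ x, Φ x = φ x := fun x => rfl
  have hs : Φ.symm (φ p) = p := Φ.left_inv hp
  have hq : φ p ∈ Φ.target := Φ.map_source hp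
  have hcont : Tendsto Φ.symm (𝓝 (φ p)) (𝓝 p) := by
    have := Φ.symm.continuousAt (x := φ p) hq
    rwa [ContinuousAt, hs] at this
  refine ⟨Φ.symm, ?_, hs, ?_, ?_⟩
  -- A smooth germ must be smooth at all nearby points, not only at the base point. Invertibility of
  -- the derivative is an open condition, so the inverse is smooth at each of them.
  · have hinv : ∀ᶠ x in 𝓝 p, fderiv ℝ φ x ∈
        Set.range ((↑) : (E ≃L[ℝ] F) → E →L[ℝ] F) := by
      have h1 : ContinuousAt (fderiv ℝ φ) p := hφ.fderiv_right.contDiffAt.continuousAt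
      apply h1.eventually
      rw [he.fderiv]
      exact ContinuousLinearEquiv.nhds e
    filter_upwards [hcont.eventually hinv, hcont.eventually hφ, Φ.open_target.mem_nhds hq]
      with y ⟨e', he'⟩ h2 h3
    refine Φ.contDiffAt_symm (f₀' := e') h3 ?_ h2
    rw [he']
    exact (h2.differentiableAt hne).hasFDerivAt
  · filter_upwards [Φ.open_source.mem_nhds hp] with x hx
    exact Φ.left_inv hx
  · filter_upwards [Φ.open_target.mem_nhds hq] with y hy
    exact Φ.right_inv hy

end Calculus

/-! ### Equivalence of germs and its invariant -/

section GermEquiv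

variable {E : Type*} [NormedAddCommGroup E] [NormedSpace ℝ E]
  {F : Type*} [NormedAddCommGroup F] [NormedSpace ℝ F]
  {G : Type*} [NormedAddCommGroup G] [NormedSpace ℝ G]

/-- The germs of `f` at `p` and of `g` at `q` agree up to a germ of a diffeomorphism between the
(possibly different) source spaces. -/
def GermEquiv (f : E → ℝ) (p : E) (g : F → ℝ) (q : F) : Prop :=
  ∃ (φ : F → E) (ψ : E → F), IsSmoothGerm φ q ∧ IsSmoothGerm ψ p ∧ φ q = p ∧ ψ p = q ∧
    (∀ᶠ x in 𝓝 q, ψ (φ x) = x) ∧ (∀ᶠ x in 𝓝 p, φ (ψ x) = x) ∧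
    ∀ᶠ x in 𝓝 q, g x = f (φ x)

theorem IsSmoothGerm.tendsto {φ : E → F} {p : E} {q : F} (hφ : IsSmoothGerm φ p) (h : φ p = q) :
    Tendsto φ (𝓝 p) (𝓝 q) := h ▸ hφ.contDiffAt.continuousAt

theorem GermEquiv.symm {f : E → ℝ} {p : E} {g : F → ℝ} {q : F} (h : GermEquiv f p g q) :
    GermEquiv g q f p := by
  obtain ⟨φ, ψ, hφ, hψ, hq, hp, h1, h2, h3⟩ := h
  refine ⟨ψ, φ, hψ, hφ, hp, hq, h2, h1, ?_⟩
  filter_upwards [(hψ.tendsto hp).eventually h3, h2] with x h4 h5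
  rw [h4, h5]

theorem GermEquiv.trans {f : E → ℝ} {p : E} {g : F → ℝ} {q : F} {h : G → ℝ} {o : G}
    (h₁ : GermEquiv f p g q) (h₂ : GermEquiv g q h o) : GermEquiv f p h o := by
  obtain ⟨φ, ψ, hφ, hψ, hq, hp, h1, h2, h3⟩ := h₁
  obtain ⟨φ', ψ', hφ', hψ', hq', hp', h1', h2', h3'⟩ := h₂
  refine ⟨fun x => φ (φ' x), fun x => ψ' (ψ x), hφ.comp_of_eq hφ' hq', hψ'.comp_of_eq hψ hp,
    by simp [hq, hq'], by simp [hp, hp'], ?_, ?_, ?_⟩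
  · filter_upwards [(hφ'.tendsto hq').eventually h1, h1'] with x h4 h5
    rw [h4, h5]
  · filter_upwards [(hψ.tendsto hp).eventually h2', h2] with x h4 h5
    rw [h4, h5]
  · filter_upwards [(hφ'.tendsto hq').eventually h3, h3'] with x h4 h5
    rw [h5, h4]

theorem GermEquiv.of_hasFDerivAt [CompleteSpace F] {f : E → ℝ} {p : E} {g : F → ℝ} {q : F}
    {φ : F → E} (hφ : IsSmoothGerm φ q) {e : F ≃L[ℝ] E} (he : HasFDerivAt φ (e : F →L[ℝ] E) q)
    (hq : φ q = p) (h : ∀ᶠ x in 𝓝 q, g x = f (φ x)) : GermEquiv f p g q := by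
  obtain ⟨ψ, h1, h2, h3, h4⟩ := hφ.exists_inverse he
  rw [hq] at h1 h2 h4
  exact ⟨φ, ψ, hφ, h1, hq, h2, h3, h4, h⟩

/-- The point `p` is isolated among the critical points of `f`. -/
def IsolatedCritical (f : E → ℝ) (p : E) : Prop :=
  ∀ᶠ x in 𝓝 p, fderiv ℝ f x = 0 → x = p

/-- By the chain rule diffeomorphisms carry critical points to critical points. This invariant
underlies every proof of non-determinacy below. -/
theorem GermEquiv.isolatedCritical {f : E → ℝ} {p : E} {g : F → ℝ} {q : F}
    (h : GermEquiv f p g q) (hf : IsSmoothGerm f p) (hg : IsolatedCritical g q) :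
    IsolatedCritical f p := by
  obtain ⟨φ, ψ, hφ, hψ, hq, hp, h1, h2, h3⟩ := h
  filter_upwards [(hψ.tendsto hp).eventually hg, h2, hf.eventually_differentiableAt,
    (hψ.tendsto hp).eventually hφ.eventually_differentiableAt,
    (hψ.tendsto hp).eventually h3.eventually_nhds] with x hx1 hx2 hx3 hx4 hx5 hx0
  have h6 : fderiv ℝ g (ψ x) = 0 := by
    have : g =ᶠ[𝓝 (ψ x)] fun y => f (φ y) := hx5
    rw [this.fderiv_eq, fderiv_fun_comp (ψ x) (by rwa [hx2]) hx4, hx2, hx0,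
      ContinuousLinearMap.zero_comp]
  rw [← hx2, hx1 h6, hq]

end GermEquiv

/-! ### Square roots near the identity of a Banach algebra -/

section SquareRoot

/-- The derivative of squaring at `1` is multiplication by 2, so squaring is locally invertible.
Both composites matter: one gives existence of the root, the other its uniqueness near `1`. -/
theorem exists_sqrt (R : Type*) [NormedRing R] [NormedAlgebra ℝ R] [CompleteSpace R] :
    ∃ ρ : R → R, IsSmoothGerm ρ 1 ∧ ρ 1 = 1 ∧
      (∀ᶠ X in 𝓝 (1 : R), ρ (X * X) = X) ∧ ∀ᶠ Y in 𝓝 (1 : R), ρ Y * ρ Y = Y := by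
  have hφ : IsSmoothGerm (fun X : R => X * X) 1 := .of_contDiff (contDiff_id.mul contDiff_id) _
  let e : R ≃L[ℝ] R := ContinuousLinearEquiv.smulLeft (Units.mk0 (2 : ℝ) two_ne_zero)
  have he : HasFDerivAt (fun X : R => X * X) (e : R →L[ℝ] R) 1 := by
    refine ((hasFDerivAt_id (𝕜 := ℝ) (1 : R)).mul' (hasFDerivAt_id (1 : R))).congr_fderiv ?_
    ext X
    change (1 : R) • X + X * 1 = (2 : ℝ) • X
    rw [one_smul, mul_one, two_smul]
  obtain ⟨ρ, h1, h2, h3, h4⟩ := hφ.exists_inverse he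
  simp only [one_mul] at h1 h2 h4
  exact ⟨ρ, h1, h2, h3, h4⟩

end SquareRoot

/-! ### The Morse lemma with parameters -/

section Morse

variable {W T : Type} [NormedAddCommGroup W] [NormedSpace ℝ W] [NormedAddCommGroup T]
  [NormedSpace ℝ T]

theorem hasFDerivAt_clm_apply_self_zero {B : W → W →L[ℝ] ℝ} (hB : DifferentiableAt ℝ B 0) :
    HasFDerivAt (fun w => B w w) (B 0) 0 := by
  refine (hB.hasFDerivAt.clm_apply (hasFDerivAt_id 0)).congr_fderiv ?_
  ext w
  simp

/-- Hadamard's lemma is applied twice. The linear coefficient at `(0, t)` is the derivative along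
`W`, which vanishes by `hcrit`, so it is itself linear in `w` to leading order. -/
theorem exists_bilinear_remainder [FiniteDimensional ℝ W] [FiniteDimensional ℝ T]
    {F : W × T → ℝ} (hF : IsSmoothGerm F 0)
    (hcrit : ∀ᶠ t in 𝓝 (0 : T), ∀ w, fderiv ℝ F (0, t) (w, 0) = 0) :
    ∃ B : W × T → W →L[ℝ] W →L[ℝ] ℝ, IsSmoothGerm B 0 ∧
      ∀ᶠ p in 𝓝 (0 : W × T), F p = F (0, p.2) + B p p.1 p.1 := by
  obtain ⟨B₁, hB₁, hF₁⟩ := hF.hadamard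
  obtain ⟨B₂, hB₂, hF₂⟩ := hB₁.hadamard
  have hj : Tendsto (fun t : T => ((0 : W), t)) (𝓝 0) (𝓝 0) :=
    (by fun_prop : Continuous fun t : T => ((0 : W), t)).tendsto' _ _ rfl
  have h0 : ∀ᶠ t in 𝓝 (0 : T), B₁ (0, t) = 0 := by
    filter_upwards [hcrit, hj.eventually hF₁.eventually_nhds,
      hj.eventually hB₁.eventually_differentiableAt,
      hj.eventually hF.eventually_differentiableAt] with t h1 h2 h3 h4
    have hi : HasFDerivAt (fun w : W => (w, t)) (ContinuousLinearMap.inl ℝ W T) 0 :=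
      hasFDerivAt_prodMk_left 0 t
    have h5 : HasFDerivAt (fun w => F (w, t))
        ((fderiv ℝ F (0, t)).comp (ContinuousLinearMap.inl ℝ W T)) 0 :=
      HasFDerivAt.comp (0 : W) (g := F) h4.hasFDerivAt hi
    have h6 : HasFDerivAt (fun w => F (w, t)) (B₁ (0, t)) 0 := by
      have h7 := (hasFDerivAt_clm_apply_self_zero (B := fun w => B₁ (w, t))
        (DifferentiableAt.comp (0 : W) (g := B₁) h3 hi.differentiableAt)).const_add (F (0, t))
      refine h7.congr_of_eventuallyEq ?_
      exact hi.continuousAt.eventually h2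
    rw [h6.unique h5]
    ext w
    simpa using h1 w
  refine ⟨B₂, hB₂, ?_⟩
  have hk : Tendsto (fun p : W × T => p.2) (𝓝 0) (𝓝 0) := continuous_snd.tendsto' _ _ rfl
  filter_upwards [hF₁, hF₂, hk.eventually h0] with p h1 h2 h3
  rw [h1, h2, h3, zero_add]

theorem hasDerivAt_sq_mul_deriv {h : ℝ → ℝ} (hh : IsSmoothGerm h 0) :
    HasDerivAt (deriv fun s => s ^ 2 * h s) (2 * h 0) 0 := by
  have h1 : deriv (fun s => s ^ 2 * h s) =ᶠ[𝓝 0] fun s => 2 * s * h s + s ^ 2 * deriv h s := by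
    filter_upwards [hh.eventually_differentiableAt] with s hs
    have := (hasDerivAt_pow 2 s).mul hs.hasDerivAt
    refine this.deriv.trans ?_
    simp
  have h2 : DifferentiableAt ℝ (deriv h) 0 := by
    have : deriv h = fun s => fderiv ℝ h s 1 := by ext s; simp
    rw [this]
    exact hh.fderiv_right.differentiableAt.clm_apply (differentiableAt_const _)
  refine HasDerivAt.congr_of_eventuallyEq ?_ h1
  have h3 := (((hasDerivAt_id (0 : ℝ)).const_mul 2).mul hh.differentiableAt.hasDerivAt).add
    ((hasDerivAt_pow 2 (0 : ℝ)).mul h2.hasDerivAt)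
  refine h3.congr_deriv ?_
  simp

/-- Restricted to the line `s ↦ s • x`, the remainder is `s²` times a smooth function, whose second
derivative at `0` is explicit. Only the quadratic form of `B 0` is determined, since `B` need not be
symmetric. -/
theorem bilinear_remainder_zero {F : W × T → ℝ} (hF : IsSmoothGerm F 0)
    {B : W × T → W →L[ℝ] W →L[ℝ] ℝ} (hB : IsSmoothGerm B 0)
    (hFB : ∀ᶠ p in 𝓝 (0 : W × T), F p = F (0, p.2) + B p p.1 p.1) (x : W) :
    fderiv ℝ (fderiv ℝ F) 0 (x, 0) (x, 0) = 2 * B 0 x x := by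
  have hc : ContDiff ℝ ∞ fun s : ℝ => (s • x, (0 : T)) := by fun_prop
  have hcd : ∀ s : ℝ, HasDerivAt (fun s : ℝ => (s • x, (0 : T))) (x, 0) s := fun s => by
    simpa using ((hasDerivAt_id s).smul_const x).prodMk (hasDerivAt_const s (0 : T))
  have hc0 : Tendsto (fun s : ℝ => (s • x, (0 : T))) (𝓝 0) (𝓝 0) :=
    hc.continuous.tendsto' _ _ (by simp)
  have hh : IsSmoothGerm (fun s : ℝ => B (s • x, 0) x x) 0 :=
    ((hB.comp_of_eq (.of_contDiff hc 0) (by simp)).clm_apply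
      (.of_contDiff contDiff_const _)).clm_apply (.of_contDiff contDiff_const _)
  have h1 := hasDerivAt_sq_mul_deriv hh
  have h2 : HasDerivAt (fun s : ℝ => fderiv ℝ F (s • x, 0) (x, 0))
      (fderiv ℝ (fderiv ℝ F) 0 (x, 0) (x, 0)) 0 := by
    have h3 : HasFDerivAt (fderiv ℝ F) (fderiv ℝ (fderiv ℝ F) 0) ((0 : ℝ) • x, (0 : T)) := by
      rw [zero_smul]
      exact hF.fderiv_right.differentiableAt.hasFDerivAt
    have h4 := h3.comp_hasDerivAt 0 (hcd 0)
    simpa using h4.clm_apply (hasDerivAt_const (0 : ℝ) ((x, 0) : W × T))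
  have h5 : (fun s : ℝ => fderiv ℝ F (s • x, 0) (x, 0)) =ᶠ[𝓝 0]
      deriv fun s => s ^ 2 * B (s • x, 0) x x := by
    filter_upwards [hc0.eventually hF.eventually_differentiableAt,
      (hc0.eventually hFB).eventually_nhds] with s h6 h7
    have h8 := h6.hasFDerivAt.comp_hasDerivAt s (hcd s)
    rw [← h8.deriv]
    have h9 : (F ∘ fun s : ℝ => (s • x, (0 : T))) =ᶠ[𝓝 s]
        fun s => F (0, 0) + s ^ 2 * B (s • x, 0) x x := by
      filter_upwards [h7] with s' h10
      simp only [Function.comp_apply, h10, map_smul, smul_apply, smul_eq_mul]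
      ring
    rw [h9.deriv_eq, deriv_const_add]
  have h10 := (h1.congr_of_eventuallyEq h5).unique h2
  rw [← h10]
  simp [← Prod.zero_eq_mk]

/-- The adjoint of an endomorphism with respect to the bilinear form `A`. -/
noncomputable def formAdjoint (A : W ≃L[ℝ] (W →L[ℝ] ℝ)) (X : W →L[ℝ] W) : W →L[ℝ] W :=
  (A.symm : (W →L[ℝ] ℝ) →L[ℝ] W).comp
    (((ContinuousLinearMap.compL ℝ W W ℝ).flip X).comp (A : W →L[ℝ] W →L[ℝ] ℝ))

theorem formAdjoint_apply (A : W ≃L[ℝ] (W →L[ℝ] ℝ)) (X : W →L[ℝ] W) (x y : W) :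
    A (formAdjoint A X x) y = A x (X y) := by
  simp [formAdjoint]

theorem contDiff_formAdjoint (A : W ≃L[ℝ] (W →L[ℝ] ℝ)) : ContDiff ℝ ∞ (formAdjoint A) := by
  unfold formAdjoint
  fun_prop

/-- The Morse lemma with parameters. -/
theorem exists_morse [FiniteDimensional ℝ W] [FiniteDimensional ℝ T]
    {F : W × T → ℝ} (hF : IsSmoothGerm F 0)
    (hcrit : ∀ᶠ t in 𝓝 (0 : T), ∀ w, fderiv ℝ F (0, t) (w, 0) = 0)
    (A : W ≃L[ℝ] (W →L[ℝ] ℝ))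
    (hA : ∀ x y, fderiv ℝ (fderiv ℝ F) 0 (x, 0) (y, 0) = A x y) :
    ∃ R : W × T → W →L[ℝ] W, IsSmoothGerm R 0 ∧ R 0 = 1 ∧
      ∀ᶠ p in 𝓝 (0 : W × T), F p = F (0, p.2) + 2⁻¹ * A (R p p.1) (R p p.1) := by
  have : CompleteSpace W := FiniteDimensional.complete ℝ W
  have hAsymm : ∀ x y, A x y = A y x := fun x y => by
    rw [← hA, ← hA]
    exact hF.contDiffAt.isSymmSndFDerivAt (by simp [ENat.LEInfty.out]) _ _
  have hAext : ∀ x y, (∀ z, A x z = A y z) → x = y := fun x y h =>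
    A.injective (ContinuousLinearMap.ext h)
  obtain ⟨B, hB, hFB⟩ := exists_bilinear_remainder hF hcrit
  let Λ : (W →L[ℝ] W →L[ℝ] ℝ) →L[ℝ] (W →L[ℝ] W) :=
    ContinuousLinearMap.compL ℝ W (W →L[ℝ] ℝ) W (A.symm : (W →L[ℝ] ℝ) →L[ℝ] W)
  -- `C p` represents the symmetrization of `B p` with respect to `A`. It is therefore self-adjoint
  -- for `A`, satisfies `A (C p w) w = 2 * B p w w`, and equals `1` at the origin.
  let C : W × T → W →L[ℝ] W := fun p => Λ (B p) + formAdjoint A (Λ (B p))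
  have hΛB : IsSmoothGerm (fun p => Λ (B p)) 0 := .comp (.of_contDiff (by fun_prop) _) hB
  have hC : IsSmoothGerm C 0 := hΛB.add (.comp (.of_contDiff (contDiff_formAdjoint A) _) hΛB)
  have hCA : ∀ p x y, A (C p x) y = B p x y + B p y x := fun p x y => by
    rw [add_apply, map_add, add_apply, formAdjoint_apply, hAsymm x]
    simp [Λ]
  have hB0 : ∀ x, 2 * B 0 x x = A x x := fun x => by
    rw [← bilinear_remainder_zero hF hB hFB x, hA]
  have hC0 : C 0 = 1 := by
    ext x
    refine hAext _ _ fun y => ?_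
    have h1 := hB0 (x + y)
    simp only [map_add, add_apply] at h1
    rw [hCA, one_apply_eq_self]
    linarith [hB0 x, hB0 y, hAsymm x y]
  have hCstar : ∀ p, formAdjoint A (C p) = C p := fun p => by
    ext x
    refine hAext _ _ fun y => ?_
    rw [formAdjoint_apply, hAsymm, hCA, hCA, add_comm]
  have hmul : ∀ X, formAdjoint A X * formAdjoint A X = formAdjoint A (X * X) := fun X => by
    ext x
    refine hAext _ _ fun y => ?_
    simp [formAdjoint_apply]
  obtain ⟨ρ, hρ, hρ1, hρl, hρr⟩ := exists_sqrt (W →L[ℝ] W)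
  have hR : IsSmoothGerm (fun p => ρ (C p)) 0 := hρ.comp_of_eq hC hC0
  have hR0 : ρ (C 0) = 1 := by rw [hC0, hρ1]
  -- The adjoint of the root of `C p` also squares to `C p` and is close to `1`. By local uniqueness
  -- of roots it is the root itself, and then `A (R w) (R w) = A (C w) w`.
  have hstar : Tendsto (fun p => formAdjoint A (ρ (C p))) (𝓝 0) (𝓝 1) := by
    have h1 : formAdjoint A 1 = 1 := by
      ext x
      refine hAext _ _ fun y => ?_
      simp [formAdjoint_apply]
    have h2 := ((contDiff_formAdjoint A).continuous.tendsto 1).comp (hR.tendsto hR0)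
    rwa [h1] at h2
  refine ⟨fun p => ρ (C p), hR, hR0, ?_⟩
  filter_upwards [hFB, hstar.eventually hρl, (hC.tendsto hC0).eventually hρr] with p h1 h2 h3
  have h4 : formAdjoint A (ρ (C p)) = ρ (C p) := by
    rw [← h2, hmul, h3, hCstar]
  have h5 : A (ρ (C p) p.1) (ρ (C p) p.1) = A (C p p.1) p.1 := by
    rw [← formAdjoint_apply, h4]
    exact congrArg (fun X : W →L[ℝ] W => A (X p.1) p.1) h3
  rw [h5, hCA, h1]
  ring

end Morse

/-! ### The splitting lemma with an error estimate -/

section Splitting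

theorem tendsto_inr {W T : Type*} [NormedAddCommGroup W] [NormedAddCommGroup T] :
    Tendsto (fun t : T => ((0 : W), t)) (𝓝 0) (𝓝 0) :=
  (by fun_prop : Continuous fun t : T => ((0 : W), t)).tendsto' _ _ rfl

theorem tendsto_snd_zero {W T : Type*} [NormedAddCommGroup W] [NormedAddCommGroup T] :
    Tendsto (fun p : W × T => p.2) (𝓝 0) (𝓝 0) :=
  continuous_snd.tendsto' _ _ rfl

variable {W T : Type} [NormedAddCommGroup W] [NormedSpace ℝ W] [NormedAddCommGroup T]
  [NormedSpace ℝ T]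

/-- The critical points of `F (·, t)` near `0` form a smooth section. -/
theorem exists_critical_section [CompleteSpace W] [CompleteSpace T] {F : W × T → ℝ}
    (hF : IsSmoothGerm F 0)
    (A : W ≃L[ℝ] (W →L[ℝ] ℝ)) (hcrit : ∀ w, fderiv ℝ F 0 (w, 0) = 0)
    (hA : ∀ x s y, fderiv ℝ (fderiv ℝ F) 0 (x, s) (y, 0) = A x y) :
    ∃ γ : T → W, IsSmoothGerm γ 0 ∧ γ 0 = 0 ∧
      (∀ᶠ t in 𝓝 (0 : T), ∀ w, fderiv ℝ F (γ t, t) (w, 0) = 0) ∧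
      γ =O[𝓝 0] fun t => (fderiv ℝ F (0, t)).comp (ContinuousLinearMap.inl ℝ W T) := by
  let ι : (W × T →L[ℝ] ℝ) →L[ℝ] (W →L[ℝ] ℝ) :=
    (ContinuousLinearMap.compL ℝ W (W × T) ℝ).flip (ContinuousLinearMap.inl ℝ W T)
  -- Since the mixed second derivatives vanish, the derivative of `Θ` at the origin is `A` times the
  -- identity. The section of critical points is the preimage of `{0} × T` under `Θ`.
  let Θ : W × T → (W →L[ℝ] ℝ) × T := fun p => (ι (fderiv ℝ F p), p.2)
  have hΘ : IsSmoothGerm Θ 0 :=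
    (IsSmoothGerm.comp (.of_contDiff (by fun_prop) _) hF.fderiv_right).prodMk
      (.of_contDiff contDiff_snd _)
  have hΘ0 : Θ 0 = 0 := by
    refine Prod.ext (ContinuousLinearMap.ext fun w => ?_) rfl
    simpa [Θ, ι] using hcrit w
  let e : (W × T) ≃L[ℝ] ((W →L[ℝ] ℝ) × T) := A.prodCongr (ContinuousLinearEquiv.refl ℝ T)
  have he : HasFDerivAt Θ (e : W × T →L[ℝ] (W →L[ℝ] ℝ) × T) 0 := by
    have h1 := (ι.hasFDerivAt.comp (0 : W × T)
      hF.fderiv_right.differentiableAt.hasFDerivAt).prodMk (hasFDerivAt_snd (𝕜 := ℝ) (p := (0 : W × T)))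
    refine h1.congr_fderiv (ContinuousLinearMap.ext fun p => ?_)
    refine Prod.ext (ContinuousLinearMap.ext fun y => ?_) rfl
    simpa [ι, e] using hA p.1 p.2 y
  obtain ⟨ψ, hψ, hψ0, hl, hr⟩ := hΘ.exists_inverse he
  rw [hΘ0] at hψ hψ0 hr
  have hj : IsSmoothGerm (fun t : T => ((0 : W →L[ℝ] ℝ), t)) 0 := .of_contDiff (by fun_prop) _
  have hsec : ∀ᶠ t in 𝓝 (0 : T), Θ (ψ (0, t)) = (0, t) := tendsto_inr.eventually hr
  refine ⟨fun t => (ψ (0, t)).1, IsSmoothGerm.comp (.of_contDiff contDiff_fst _)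
    (hψ.comp_of_eq hj rfl), by simp [← Prod.zero_eq_mk, hψ0], ?_, ?_⟩
  · filter_upwards [hsec] with t ht w
    have h1 : ι (fderiv ℝ F (ψ (0, t))) = 0 := congrArg Prod.fst ht
    have h2 : (ψ (0, t)).2 = t := congrArg Prod.snd ht
    have h3 : ((ψ (0, t)).1, t) = ψ (0, t) := Prod.ext rfl h2.symm
    rw [h3]
    simpa [ι] using DFunLike.congr_fun h1 w
  -- The points `(γ t, t)` and `(0, t)` are the images under the Lipschitz inverse of two points
  -- whose distance is the norm of the fibre derivative at `(0, t)`.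
  · obtain ⟨K, s, hs, hK⟩ := (hψ.contDiffAt.of_le (m := 1) (by simp)).exists_lipschitzOnWith
    refine Asymptotics.IsBigO.of_bound K ?_
    have h0 : Tendsto (fun t : T => Θ (0, t)) (𝓝 0) (𝓝 0) :=
      (hΘ.tendsto hΘ0).comp tendsto_inr
    filter_upwards [tendsto_inr.eventually hl, tendsto_inr.eventually hs, h0.eventually hs]
      with t h1 h2 h3
    have h4 := hK.dist_le_mul _ h2 _ h3
    rw [h1, dist_eq_norm, dist_eq_norm] at h4
    have h5 : ‖(ψ (0, t)).1‖ ≤ ‖ψ (0, t) - (0, t)‖ := by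
      have := norm_fst_le (ψ (0, t) - (0, t))
      rwa [Prod.fst_sub, sub_zero] at this
    refine h5.trans (h4.trans_eq ?_)
    congr 1
    simp only [Θ, Prod.mk_sub_mk, sub_self, zero_sub, Prod.norm_def, norm_neg, norm_zero]
    exact max_eq_left (norm_nonneg _)

theorem GermEquiv.shear {F : W × T → ℝ} {γ : T → W} (hγ : IsSmoothGerm γ 0) (hγ0 : γ 0 = 0) :
    GermEquiv F 0 (fun p => F (p.1 + γ p.2, p.2)) (0 : W × T) := by
  have h2 : IsSmoothGerm (fun p : W × T => γ p.2) 0 :=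
    hγ.comp_of_eq (.of_contDiff contDiff_snd _) rfl
  have h1 : IsSmoothGerm (fun p : W × T => p.1) 0 := .of_contDiff contDiff_fst _
  have h3 : IsSmoothGerm (fun p : W × T => p.2) 0 := .of_contDiff contDiff_snd _
  exact ⟨fun p => (p.1 + γ p.2, p.2), fun p => (p.1 - γ p.2, p.2), (h1.add h2).prodMk h3,
    (h1.sub h2).prodMk h3, by simp [hγ0], by simp [hγ0], by simp, by simp, by simp⟩

/-- The splitting lemma. -/
theorem exists_splitting [FiniteDimensional ℝ W] [FiniteDimensional ℝ T] {F : W × T → ℝ}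
    (hF : IsSmoothGerm F 0)
    (A : W ≃L[ℝ] (W →L[ℝ] ℝ)) (hcrit : ∀ w, fderiv ℝ F 0 (w, 0) = 0)
    (hA : ∀ x s y, fderiv ℝ (fderiv ℝ F) 0 (x, s) (y, 0) = A x y) :
    ∃ r : T → ℝ, IsSmoothGerm r 0 ∧
      GermEquiv F 0 (fun p => r p.2 + 2⁻¹ * A p.1 p.1) (0 : W × T) ∧
      (fun t => F (0, t) - r t) =O[𝓝 0]
        fun t => ‖(fderiv ℝ F (0, t)).comp (ContinuousLinearMap.inl ℝ W T)‖ ^ 2 := by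
  have : CompleteSpace W := FiniteDimensional.complete ℝ W
  have : CompleteSpace T := FiniteDimensional.complete ℝ T
  obtain ⟨γ, hγ, hγ0, hγc, hγO⟩ := exists_critical_section hF A hcrit hA
  have hγ2 : IsSmoothGerm (fun p : W × T => γ p.2) 0 :=
    hγ.comp_of_eq (.of_contDiff contDiff_snd _) rfl
  have h1 : IsSmoothGerm (fun p : W × T => p.1) 0 := .of_contDiff contDiff_fst _
  have h2 : IsSmoothGerm (fun p : W × T => p.2) 0 := .of_contDiff contDiff_snd _
  let σ : W × T → W × T := fun p => (p.1 + γ p.2, p.2)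
  have hσ : IsSmoothGerm σ 0 := (h1.add hγ2).prodMk h2
  have hσ0 : σ 0 = 0 := by simp [σ, hγ0]
  let F₁ : W × T → ℝ := fun p => F (σ p)
  have hF₁ : IsSmoothGerm F₁ 0 := hF.comp_of_eq hσ hσ0
  have hσd : ∀ᶠ p in 𝓝 (0 : W × T), ∀ w, fderiv ℝ σ p (w, 0) = (w, 0) := by
    filter_upwards [tendsto_snd_zero.eventually hγ.eventually_differentiableAt] with p hp w
    have h3 : HasFDerivAt σ _ p := (hasFDerivAt_fst.add
      (hp.hasFDerivAt.comp p hasFDerivAt_snd)).prodMk hasFDerivAt_snd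
    rw [h3.fderiv]
    simp
  have hFd : ∀ᶠ p in 𝓝 (0 : W × T), ∀ w, fderiv ℝ F₁ p (w, 0) = fderiv ℝ F (σ p) (w, 0) := by
    filter_upwards [hσd, hσ.eventually_differentiableAt,
      (hσ.tendsto hσ0).eventually hF.eventually_differentiableAt] with p h3 h4 h5 w
    rw [fderiv_fun_comp p h5 h4, ContinuousLinearMap.comp_apply, h3]
  have hcrit₁ : ∀ᶠ t in 𝓝 (0 : T), ∀ w, fderiv ℝ F₁ (0, t) (w, 0) = 0 := by
    filter_upwards [hγc, tendsto_inr.eventually hFd] with t h3 h4 w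
    rw [h4, ← h3 w]
    simp [σ]
  have hA₁ : ∀ x y, fderiv ℝ (fderiv ℝ F₁) 0 (x, 0) (y, 0) = A x y := fun x y => by
    have h3 : (fun p => fderiv ℝ F₁ p (y, 0)) =ᶠ[𝓝 0] fun p => fderiv ℝ F (σ p) (y, 0) := by
      filter_upwards [hFd] with p hp using hp y
    have h4 : HasFDerivAt (fun p => fderiv ℝ F₁ p (y, 0)) _ 0 :=
      hF₁.fderiv_right.differentiableAt.hasFDerivAt.clm_apply (hasFDerivAt_const _ _)
    have h5 : HasFDerivAt (fun p => fderiv ℝ F (σ p) (y, 0)) _ 0 :=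
      HasFDerivAt.clm_apply (HasFDerivAt.comp (0 : W × T) (g := fderiv ℝ F)
        (hσ0.symm ▸ hF.fderiv_right.differentiableAt.hasFDerivAt)
        hσ.differentiableAt.hasFDerivAt) (hasFDerivAt_const _ _)
    have h6 := DFunLike.congr_fun (h4.unique (h5.congr_of_eventuallyEq h3)) (x, 0)
    simp only [ContinuousLinearMap.comp_zero, zero_add, ContinuousLinearMap.flip_apply,
      ContinuousLinearMap.comp_apply, hσd.self_of_nhds x] at h6
    rw [h6, hσ0, hA]
  obtain ⟨R, hR, hR0, hFR⟩ := exists_morse hF₁ hcrit₁ A hA₁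
  have hr : IsSmoothGerm (fun t => F₁ (0, t)) 0 :=
    hF₁.comp_of_eq (.of_contDiff (by fun_prop) _) rfl
  refine ⟨fun t => F₁ (0, t), hr, (GermEquiv.shear hγ hγ0).trans (GermEquiv.symm ?_), ?_⟩
  · have h3 : HasFDerivAt (fun p : W × T => (R p p.1, p.2))
        (ContinuousLinearEquiv.refl ℝ (W × T) : W × T →L[ℝ] W × T) 0 := by
      have h4 := (hR.differentiableAt.hasFDerivAt.clm_apply
        (hasFDerivAt_fst (𝕜 := ℝ) (p := (0 : W × T)))).prodMk
        (hasFDerivAt_snd (𝕜 := ℝ) (p := (0 : W × T)))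
      refine h4.congr_fderiv (ContinuousLinearMap.ext fun p => ?_)
      simp [hR0]
    exact GermEquiv.of_hasFDerivAt ((hR.clm_apply h1).prodMk h2) h3 (by simp) hFR
  -- In coordinates centred on the critical section, `(0, t)` becomes `(-γ t, t)`. The value there
  -- exceeds the critical one by a form quadratic in `γ t`, hence the square in the estimate.
  · refine Asymptotics.IsBigO.trans ?_ (hγO.norm_norm.pow 2)
    have hlim : Tendsto (fun t => (-γ t, t)) (𝓝 0) (𝓝 (0 : W × T)) := by
      have h3 : ContinuousAt (fun t => (-γ t, t)) 0 :=
        hγ.contDiffAt.continuousAt.neg.prodMk continuousAt_id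
      simp only [ContinuousAt, hγ0, neg_zero] at h3
      exact h3
    have hRb : ∀ᶠ p in 𝓝 (0 : W × T), ‖R p‖ < ‖(1 : W →L[ℝ] W)‖ + 1 :=
      (hR.tendsto hR0).norm.eventually (gt_mem_nhds (lt_add_one _))
    set M := ‖(1 : W →L[ℝ] W)‖ + 1
    refine Asymptotics.IsBigO.of_bound (2⁻¹ * (‖(A : W →L[ℝ] W →L[ℝ] ℝ)‖ * M * M)) ?_
    filter_upwards [hlim.eventually hFR, hlim.eventually hRb] with t h3 h4
    have h5 : F (0, t) - F₁ (0, t) = 2⁻¹ * A (R (-γ t, t) (-γ t)) (R (-γ t, t) (-γ t)) := by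
      have h6 : F₁ (-γ t, t) = F (0, t) := by simp [F₁, σ]
      rw [← h6, h3]
      ring
    have h7 : ‖R (-γ t, t) (-γ t)‖ ≤ M * ‖γ t‖ :=
      ((R (-γ t, t)).le_opNorm _).trans (by rw [norm_neg]; gcongr)
    rw [h5, norm_mul, Real.norm_of_nonneg (by norm_num : (0 : ℝ) ≤ 2⁻¹), mul_assoc, norm_pow,
      norm_norm]
    gcongr
    calc ‖A (R (-γ t, t) (-γ t)) (R (-γ t, t) (-γ t))‖
        ≤ ‖(A : W →L[ℝ] W →L[ℝ] ℝ)‖ * ‖R (-γ t, t) (-γ t)‖ * ‖R (-γ t, t) (-γ t)‖ :=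
          (A : W →L[ℝ] W →L[ℝ] ℝ).le_opNorm₂ _ _
      _ ≤ ‖(A : W →L[ℝ] W →L[ℝ] ℝ)‖ * (M * ‖γ t‖) * (M * ‖γ t‖) := by gcongr
      _ = _ := by ring

end Splitting

/-! ### Comparison of jets -/

section Jets

variable {E : Type*} [NormedAddCommGroup E] [NormedSpace ℝ E]

theorem SameJet.congr {k : ℕ} {f f' g g' : E → ℝ} {p : E} (h : SameJet k f g p)
    (hf : f' =ᶠ[𝓝 p] f) (hg : g' =ᶠ[𝓝 p] g) : SameJet k f' g' p := fun m hm => by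
  rw [(hf.iteratedFDeriv ℝ m).eq_of_nhds, (hg.iteratedFDeriv ℝ m).eq_of_nhds, h m hm]

theorem SameJet.mono {k l : ℕ} (hkl : k ≤ l) {f g : E → ℝ} {p : E} (h : SameJet l f g p) :
    SameJet k f g p := fun m hm => h m (hm.trans hkl)

theorem SameJet.eq {k : ℕ} {f g : E → ℝ} {p : E} (h : SameJet k f g p) : f p = g p := by
  have := h 0 (Nat.zero_le k)
  simpa using DFunLike.congr_fun this 0

theorem SameJet.fderiv_apply {k : ℕ} {f g : E → ℝ} {p : E} (h : SameJet (k + 1) f g p)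
    (hf : IsSmoothGerm f p) (hg : IsSmoothGerm g p) (v : E) :
    SameJet k (fun x => fderiv ℝ f x v) (fun x => fderiv ℝ g x v) p := fun m hm => by
  have h1 : iteratedFDeriv ℝ m (fderiv ℝ f) p = iteratedFDeriv ℝ m (fderiv ℝ g) p := by
    have h2 := h (m + 1) (by omega)
    rw [iteratedFDeriv_succ_eq_comp_right, iteratedFDeriv_succ_eq_comp_right] at h2
    exact (continuousMultilinearCurryRightEquiv' ℝ m E ℝ).symm.injective h2
  have h2 : ∀ f : E → ℝ, IsSmoothGerm f p → iteratedFDeriv ℝ m (fun x => fderiv ℝ f x v) p =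
      (ContinuousLinearMap.apply ℝ ℝ v).compContinuousMultilinearMap
        (iteratedFDeriv ℝ m (fderiv ℝ f) p) := fun f hf =>
    (ContinuousLinearMap.apply ℝ ℝ v).iteratedFDeriv_comp_left
      (hf.fderiv_right.contDiffAt.of_le (m := m) (by exact_mod_cast le_top)) le_rfl
  rw [h2 f hf, h2 g hg, h1]

/-- One differentiation turns `τ ^ (l + 1) • H` into `τ ^ l` times a smooth map. That map is
vector-valued, so the induction runs over all targets `Y`. -/
theorem iteratedFDeriv_pow_smul_eq_zero {E : Type} [NormedAddCommGroup E] [NormedSpace ℝ E]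
    {τ : E → ℝ} {p : E} (hτ : IsSmoothGerm τ p) (h0 : τ p = 0) (m : ℕ) :
    ∀ {n : ℕ}, m < n → ∀ {Y : Type} [NormedAddCommGroup Y] [NormedSpace ℝ Y] {H : E → Y},
      IsSmoothGerm H p → iteratedFDeriv ℝ m (fun x => τ x ^ n • H x) p = 0 := by
  induction m with
  | zero =>
    intro n hn Y _ _ H _
    ext v
    simp [h0, (Nat.pos_iff_ne_zero.1 hn)]
  | succ m ih =>
    intro n hn Y _ _ H hH
    obtain ⟨l, rfl⟩ : ∃ l, n = l + 1 := ⟨n - 1, by omega⟩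
    have h1 : fderiv ℝ (fun x => τ x ^ (l + 1) • H x) =ᶠ[𝓝 p] fun x => τ x ^ l •
        (τ x • fderiv ℝ H x + ((l + 1 : ℝ) • fderiv ℝ τ x).smulRight (H x)) := by
      filter_upwards [hτ.eventually_differentiableAt, hH.eventually_differentiableAt] with x h2 h3
      have h4 : HasFDerivAt (fun x => τ x ^ (l + 1) • H x) _ x :=
        (h2.hasFDerivAt.pow (l + 1)).smul h3.hasFDerivAt
      rw [h4.fderiv]
      ext v
      simp [pow_succ, smul_smul, mul_comm, mul_assoc]
    have h2 : IsSmoothGerm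
        (fun x => τ x • fderiv ℝ H x + ((l + 1 : ℝ) • fderiv ℝ τ x).smulRight (H x)) p := by
      filter_upwards [hτ, hH, hτ.fderiv_right, hH.fderiv_right] with x h3 h4 h5 h6
      exact (h3.smul h6).add ((h5.const_smul (l + 1 : ℝ)).smulRight h4)
    rw [← norm_eq_zero, ← norm_iteratedFDeriv_fderiv, (h1.iteratedFDeriv ℝ m).eq_of_nhds,
      ih (by omega) h2, norm_zero]

theorem SameJet.add_pow_mul {E : Type} [NormedAddCommGroup E] [NormedSpace ℝ E]
    {g : E → ℝ} {p : E} (hg : IsSmoothGerm g p)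
    {τ : E → ℝ} (hτ : IsSmoothGerm τ p) (h0 : τ p = 0) {k n : ℕ} (hkn : k < n) {H : E → ℝ}
    (hH : IsSmoothGerm H p) : SameJet k (fun x => g x + τ x ^ n * H x) g p := fun m hm => by
  have h1 : IsSmoothGerm (fun x => τ x ^ n * H x) p := by
    filter_upwards [hτ, hH] with x h3 h4 using (h3.pow n).mul h4
  have hle : (m : ℕ∞ω) ≤ ∞ := by exact_mod_cast le_top
  have h2 := iteratedFDeriv_pow_smul_eq_zero hτ h0 m (hm.trans_lt hkn) hH
  simp only [smul_eq_mul] at h2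
  have h3 := iteratedFDeriv_add_apply (𝕜 := ℝ) (i := m) (x := p) (hg.contDiffAt.of_le hle)
    (h1.contDiffAt.of_le hle)
  rw [h2, add_zero] at h3
  exact h3

end Jets

/-! ### Order of vanishing in one variable -/

section OneVariable

open Asymptotics

theorem isBigO_pow_succ_of_deriv {Y : Type*} [NormedAddCommGroup Y] [NormedSpace ℝ Y]
    {h : ℝ → Y} {h' : ℝ → Y} (hd : ∀ᶠ t in 𝓝 (0 : ℝ), HasDerivAt h (h' t) t)
    (h0 : h 0 = 0) {n : ℕ} (hO : h' =O[𝓝 0] fun t : ℝ => t ^ n) :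
    h =O[𝓝 0] fun t : ℝ => t ^ (n + 1) := by
  obtain ⟨C, hC⟩ := hO.bound
  obtain ⟨ε, hε, hball⟩ := Metric.eventually_nhds_iff_ball.1 (hd.and hC)
  refine IsBigO.of_bound C ?_
  filter_upwards [Metric.ball_mem_nhds (0 : ℝ) hε] with t ht
  have hsub : ∀ s ∈ Metric.closedBall (0 : ℝ) |t|, s ∈ Metric.ball (0 : ℝ) ε := fun s hs => by
    simp only [Metric.mem_ball, Metric.mem_closedBall, dist_zero_right, Real.norm_eq_abs]
      at ht hs ⊢
    linarith
  have h1 := (convex_closedBall (0 : ℝ) |t|).norm_image_sub_le_of_norm_hasDerivWithin_le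
    (f := h) (f' := h') (C := C * |t| ^ n) (x := 0) (y := t)
    (fun s hs => (hball s (hsub s hs)).1.hasDerivWithinAt) ?_ (by simp) (by simp)
  · rw [h0, sub_zero, sub_zero] at h1
    refine h1.trans_eq ?_
    rw [norm_pow, Real.norm_eq_abs]
    ring
  · intro s hs
    have h2 := (hball s (hsub s hs)).2
    -- The constant in a big-O bound carries no sign. A negative one forces `C * |t| ^ n = 0` and
    -- makes the derivative vanish on the ball.
    have hCn : 0 ≤ C ∨ C < 0 := le_or_gt 0 C
    rcases hCn with hCn | hCn
    · refine h2.trans ?_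
      rw [norm_pow, Real.norm_eq_abs]
      simp only [Metric.mem_closedBall, dist_zero_right, Real.norm_eq_abs] at hs
      gcongr
    · have h3 := (hball t (hsub t (by simp))).2
      have h4 := (norm_nonneg _).trans h3
      rw [norm_pow, Real.norm_eq_abs] at h4
      have h5 : C * |t| ^ n = 0 := le_antisymm (mul_nonpos_of_nonpos_of_nonneg hCn.le
        (by positivity)) h4
      rw [h5]
      refine h2.trans ?_
      exact mul_nonpos_of_nonpos_of_nonneg hCn.le (norm_nonneg _)

/-- One factor `t` is split off at a time. The current quotient is `O(t)` away from `0`, so by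
continuity it vanishes at `0` and can be divided again. -/
theorem IsSmoothGerm.exists_eq_pow_mul {n : ℕ} {σ : ℝ → ℝ} (hσ : IsSmoothGerm σ 0)
    (hO : σ =O[𝓝 0] fun t : ℝ => t ^ n) :
    ∃ h : ℝ → ℝ, IsSmoothGerm h 0 ∧ ∀ᶠ t in 𝓝 (0 : ℝ), σ t = t ^ n * h t := by
  induction n with
  | zero => exact ⟨σ, hσ, by simp⟩
  | succ n ih =>
    obtain ⟨h, hh, hσh⟩ := ih (hO.trans (IsBigO.of_bound 1 (by
      filter_upwards [Metric.ball_mem_nhds (0 : ℝ) one_pos] with t ht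
      rw [pow_succ, norm_mul, one_mul]
      exact mul_le_of_le_one_right (norm_nonneg _) (by simpa using (mem_ball_zero_iff.1 ht).le))))
    have h0 : h 0 = 0 := by
      have h1 : Tendsto h (𝓝[≠] 0) (𝓝 (h 0)) :=
        hh.contDiffAt.continuousAt.tendsto.mono_left nhdsWithin_le_nhds
      have h2 : h =O[𝓝[≠] 0] fun t : ℝ => t := by
        obtain ⟨C, hC⟩ := hO.bound
        refine IsBigO.of_bound C ?_
        filter_upwards [nhdsWithin_le_nhds hC, nhdsWithin_le_nhds hσh, self_mem_nhdsWithin]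
          with t h3 h4 h5
        have h6 : 0 < ‖t ^ n‖ := norm_pos_iff.2 (pow_ne_zero _ h5)
        rw [h4, norm_mul, pow_succ, norm_mul, mul_left_comm] at h3
        exact le_of_mul_le_mul_left h3 h6
      exact tendsto_nhds_unique h1
        (h2.trans_tendsto (tendsto_id.mono_left nhdsWithin_le_nhds))
    obtain ⟨h', hh', hhh'⟩ := hh.exists_eq_add_smul
    refine ⟨h', hh', ?_⟩
    filter_upwards [hσh, hhh'] with t h1 h2
    rw [h1, h2, h0, smul_eq_mul]
    ring

end OneVariable

/-! ### Normal forms, and the obstruction to determinacy -/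

section NormalForm

open Asymptotics

variable {W : Type} [NormedAddCommGroup W] [NormedSpace ℝ W]

/-- Write `r = c₀ + c t ^ k u(t)` with `u 0 = 1`. As `u` is positive near `0`, its `k`-th root is
smooth, and `s = t u ^ (1 / k)` is a coordinate change with `r = c₀ + c s ^ k`. -/
theorem GermEquiv.of_leading_term [CompleteSpace W] (Q : W → ℝ) {r : ℝ → ℝ}
    (hr : IsSmoothGerm r 0) {c₀ c : ℝ} (hc : c ≠ 0) {k : ℕ} (hk : k ≠ 0)
    (hO : (fun t => r t - (c₀ + c * t ^ k)) =O[𝓝 0] fun t : ℝ => t ^ (k + 1)) :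
    GermEquiv (fun p : W × ℝ => c₀ + c * p.2 ^ k + Q p.1) 0
      (fun p : W × ℝ => r p.2 + Q p.1) 0 := by
  have hpoly : IsSmoothGerm (fun t : ℝ => c₀ + c * t ^ k) 0 := .of_contDiff (by fun_prop) _
  obtain ⟨h, hh, hrh⟩ := (hr.sub hpoly).exists_eq_pow_mul hO
  let u : ℝ → ℝ := fun t => 1 + t * h t / c
  have hu : IsSmoothGerm u 0 := by
    filter_upwards [hh] with t h1
    exact contDiffAt_const.add ((contDiffAt_id.mul h1).div_const c)
  have hu0 : u 0 = 1 := by simp [u]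
  have hupos : ∀ᶠ t in 𝓝 (0 : ℝ), 0 < u t := by
    refine (hu.tendsto hu0).eventually (lt_mem_nhds one_pos)
  let s : ℝ → ℝ := fun t => t * u t ^ ((k : ℝ)⁻¹)
  have hs : IsSmoothGerm s 0 := by
    filter_upwards [hu, hupos] with t h1 h2
    exact contDiffAt_id.mul (h1.rpow_const_of_ne h2.ne')
  have hsd : HasFDerivAt s (ContinuousLinearMap.id ℝ ℝ) 0 := by
    have h1 : DifferentiableAt ℝ (fun t => u t ^ ((k : ℝ)⁻¹)) 0 :=
      hu.differentiableAt.rpow_const (Or.inl (by simp [hu0]))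
    have h2 := (hasDerivAt_id (0 : ℝ)).mul h1.hasDerivAt
    refine h2.hasFDerivAt.congr_fderiv (ContinuousLinearMap.ext fun x => ?_)
    simp [hu0]
  have h1 : HasFDerivAt (fun p : W × ℝ => (p.1, s p.2))
      (ContinuousLinearEquiv.refl ℝ (W × ℝ) : W × ℝ →L[ℝ] W × ℝ) 0 := by
    have h2 := (hasFDerivAt_fst (𝕜 := ℝ) (p := (0 : W × ℝ))).prodMk
      (HasFDerivAt.comp (0 : W × ℝ) (g := s) hsd hasFDerivAt_snd)
    exact h2.congr_fderiv (ContinuousLinearMap.ext fun p => rfl)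
  have h3 : IsSmoothGerm (fun p : W × ℝ => (p.1, s p.2)) 0 :=
    IsSmoothGerm.prodMk (.of_contDiff contDiff_fst _)
      (hs.comp_of_eq (.of_contDiff contDiff_snd _) rfl)
  refine GermEquiv.of_hasFDerivAt h3 h1 (by simp [s]) ?_
  filter_upwards [tendsto_snd_zero.eventually hrh, tendsto_snd_zero.eventually hupos]
    with p h4 h5
  have h6 : (u p.2 ^ ((k : ℝ)⁻¹)) ^ k = u p.2 := Real.rpow_inv_natCast_pow h5.le hk
  simp only [s, mul_pow, h6]
  rw [sub_eq_iff_eq_add.1 h4]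
  simp only [u]
  field_simp
  ring

variable (A : W →L[ℝ] W →L[ℝ] ℝ)

theorem hasFDerivAt_form_add_pow (hA : ∀ x y, A x y = A y x) (c₀ c : ℝ) (p : W × ℝ) :
    HasFDerivAt (fun p : W × ℝ => c₀ + c * p.2 ^ 6 + 2⁻¹ * A p.1 p.1)
      ((A p.1).comp (ContinuousLinearMap.fst ℝ W ℝ) +
        (6 * c * p.2 ^ 5) • ContinuousLinearMap.snd ℝ W ℝ) p := by
  have h1 : HasFDerivAt (fun p : W × ℝ => c₀ + c * p.2 ^ 6) _ p :=
    (((hasFDerivAt_snd (𝕜 := ℝ) (p := p)).pow 6).const_mul c).const_add c₀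
  have h2 : HasFDerivAt (fun p : W × ℝ => 2⁻¹ * A p.1 p.1) _ p :=
    ((A.hasFDerivAt.comp p (hasFDerivAt_fst (𝕜 := ℝ) (p := p))).clm_apply
      (hasFDerivAt_fst (𝕜 := ℝ) (p := p))).const_mul 2⁻¹
  refine (h1.add h2).congr_fderiv (ContinuousLinearMap.ext fun q => ?_)
  simp [hA q.1 p.1]
  ring

theorem not_isolatedCritical_form (hA : ∀ x y, A x y = A y x) (c₀ : ℝ) :
    ¬ IsolatedCritical (fun p : W × ℝ => c₀ + 0 * p.2 ^ 6 + 2⁻¹ * A p.1 p.1) 0 := by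
  intro h
  have h1 : ∀ᶠ t in 𝓝[≠] (0 : ℝ), False := by
    filter_upwards [nhdsWithin_le_nhds (tendsto_inr.eventually h), self_mem_nhdsWithin]
      with t h2 h3
    refine h3 (congrArg Prod.snd (h2 ?_))
    rw [(hasFDerivAt_form_add_pow A hA c₀ 0 (0, t)).fderiv]
    ext <;> simp
  simpa using h1.exists

theorem isolatedCritical_form_add_pow (hA : ∀ x y, A x y = A y x)
    (hinj : Function.Injective A) (c₀ : ℝ) :
    IsolatedCritical (fun p : W × ℝ => c₀ + 1 * p.2 ^ 6 + 2⁻¹ * A p.1 p.1) 0 := by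
  refine Eventually.of_forall fun p hp => ?_
  rw [(hasFDerivAt_form_add_pow A hA c₀ 1 p).fderiv] at hp
  refine Prod.ext (hinj (ContinuousLinearMap.ext fun w => ?_)) ?_
  · simpa using DFunLike.congr_fun hp (w, 0)
  · simpa using DFunLike.congr_fun hp (0, 1)

/-- The `k`-jet of `f` agrees with that of `c₀ + c t ^ 6 + A(w, w) / 2`, in the coordinates `ψ`, for
every `c`. If `f` were `k`-determined, the cases `c = 0` and `c = 1` would be equivalent; the first
has a line of critical points, the second an isolated one. The exponent 6 exceeds every `k` allowed.
-/
theorem not_isDetermined_of_germEquiv {E : Type} [NormedAddCommGroup E] [NormedSpace ℝ E]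
    (hA : ∀ x y, A x y = A y x) (hinj : Function.Injective A)
    {f : E → ℝ} {P : E} {r : ℝ → ℝ} (hr : IsSmoothGerm r 0)
    {c₀ : ℝ} {k : ℕ} (hk : k ≤ 5)
    (hO : (fun t => r t - c₀) =O[𝓝 0] fun t : ℝ => t ^ (k + 1))
    (h : GermEquiv f P (fun p : W × ℝ => r p.2 + 2⁻¹ * A p.1 p.1) 0) :
    ¬ IsDetermined k f P := by
  intro hdet
  obtain ⟨φ, ψ, hφ, hψ, hφ0, hψP, h1, h2, h3⟩ := h
  obtain ⟨η, hη, hrη⟩ := (hr.sub (.of_contDiff (contDiff_const (c := c₀)) 0)).exists_eq_pow_mul hO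
  have hτ : IsSmoothGerm (fun x => (ψ x).2) P :=
    IsSmoothGerm.comp (.of_contDiff contDiff_snd _) hψ
  have hτP : (ψ P).2 = 0 := by simp [hψP]
  let N : ℝ → W × ℝ → ℝ := fun c p => c₀ + c * p.2 ^ 6 + 2⁻¹ * A p.1 p.1
  have hN : ∀ c, ContDiff ℝ ∞ (N c) := fun c => by
    simp only [N]
    fun_prop
  have key : ∀ c, GermEquiv f P (N c) 0 := fun c => by
    have hNψ : IsSmoothGerm (fun x => N c (ψ x)) P :=
      IsSmoothGerm.comp (.of_contDiff (hN c) _) hψ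
    have hH : IsSmoothGerm (fun x => η (ψ x).2 - c * (ψ x).2 ^ (5 - k)) P := by
      refine (hη.comp_of_eq hτ hτP).sub ?_
      filter_upwards [hτ] with x h4 using contDiffAt_const.mul (h4.pow _)
    have hjet : SameJet k f (fun x => N c (ψ x)) P := by
      refine (SameJet.add_pow_mul hNψ hτ hτP (Nat.lt_add_one k) hH).congr ?_ .rfl
      filter_upwards [(hψ.tendsto hψP).eventually h3, h2,
        (hτ.tendsto hτP).eventually hrη] with x h4 h5 h6
      rw [h5] at h4
      have h7 : (ψ x).2 ^ 6 = (ψ x).2 ^ (k + 1) * (ψ x).2 ^ (5 - k) := by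
        rw [← pow_add]
        congr 1
        omega
      simp only [N]
      rw [← h4, sub_eq_iff_eq_add.1 h6, h7]
      ring
    have h4 : GermEquiv f P (fun x => N c (ψ x)) P := hdet _ hNψ hjet
    refine h4.trans ⟨φ, ψ, hφ, hψ, hφ0, hψP, h1, h2, ?_⟩
    filter_upwards [h1] with x h5
    rw [h5]
  exact not_isolatedCritical_form A hA c₀
    (((key 0).symm.trans (key 1)).isolatedCritical (.of_contDiff (hN 0) _)
      (isolatedCritical_form_add_pow A hA hinj c₀))

end NormalForm

/-! ### Second derivatives, composition and jets -/

section Hessian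

variable {E X : Type*} [NormedAddCommGroup E] [NormedSpace ℝ E] [NormedAddCommGroup X]
  [NormedSpace ℝ X]

theorem eventually_fderiv_comp_apply {f : E → ℝ} {c : X → E} {p : X}
    (hf : IsSmoothGerm f (c p)) (hc : IsSmoothGerm c p) {y : X} {v : E}
    (hy : ∀ᶠ q in 𝓝 p, fderiv ℝ c q y = v) :
    ∀ᶠ q in 𝓝 p, fderiv ℝ (fun q => f (c q)) q y = fderiv ℝ f (c q) v := by
  filter_upwards [hy, hc.eventually_differentiableAt,
    (hc.tendsto rfl).eventually hf.eventually_differentiableAt] with q h1 h2 h3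
  rw [fderiv_fun_comp q h3 h2, ContinuousLinearMap.comp_apply, h1]

/-- The usual term with the second derivative of `c` is absent because the derivative of `c` in the
direction `y` is locally constant. -/
theorem fderiv_fderiv_comp_apply {f : E → ℝ} {c : X → E} {p : X}
    (hf : IsSmoothGerm f (c p)) (hc : IsSmoothGerm c p) {y : X} {v : E}
    (hy : ∀ᶠ q in 𝓝 p, fderiv ℝ c q y = v) (x : X) :
    fderiv ℝ (fderiv ℝ fun q => f (c q)) p x y =
      fderiv ℝ (fderiv ℝ f) (c p) (fderiv ℝ c p x) v := by
  have h1 : HasFDerivAt (fun q => fderiv ℝ (fun q => f (c q)) q y) _ p :=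
    (hf.comp hc).fderiv_right.differentiableAt.hasFDerivAt.clm_apply (hasFDerivAt_const _ _)
  have h2 : HasFDerivAt (fun q => fderiv ℝ f (c q) v) _ p :=
    (hf.fderiv_right.differentiableAt.hasFDerivAt.comp p
      hc.differentiableAt.hasFDerivAt).clm_apply (hasFDerivAt_const _ _)
  have h3 := h1.unique (h2.congr_of_eventuallyEq (eventually_fderiv_comp_apply hf hc hy))
  simpa using DFunLike.congr_fun h3 x

theorem exists_continuousLinearEquiv_dual {W : Type*} [NormedAddCommGroup W] [NormedSpace ℝ W]
    [FiniteDimensional ℝ W] {D : W →L[ℝ] W →L[ℝ] ℝ} (hD : Function.Injective D) :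
    ∃ A : W ≃L[ℝ] (W →L[ℝ] ℝ), ∀ x, A x = D x := by
  have h1 : Module.finrank ℝ W = Module.finrank ℝ (W →L[ℝ] ℝ) := by
    rw [← Subspace.dual_finrank_eq]
    exact (LinearMap.toContinuousLinearMap (𝕜 := ℝ) (E := W) (F' := ℝ)).finrank_eq
  exact ⟨(LinearEquiv.ofInjectiveOfFinrankEq (D : W →ₗ[ℝ] W →L[ℝ] ℝ) hD h1).toContinuousLinearEquiv,
    fun x => rfl⟩

theorem sameJet_two {f g : E → ℝ} {p : E} (h0 : f p = g p) (h1 : fderiv ℝ f p = fderiv ℝ g p)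
    (h2 : fderiv ℝ (fderiv ℝ f) p = fderiv ℝ (fderiv ℝ g) p) : SameJet 2 f g p := by
  intro m hm
  ext v
  interval_cases m
  · simpa using h0
  · simp [iteratedFDeriv_one_apply, h1]
  · simp [iteratedFDeriv_two_apply, h2]

theorem SameJet.fderiv_eq {k : ℕ} {f g : E → ℝ} {p : E} (h : SameJet (k + 1) f g p)
    (hf : IsSmoothGerm f p) (hg : IsSmoothGerm g p) : fderiv ℝ f p = fderiv ℝ g p :=
  ContinuousLinearMap.ext fun v => (h.fderiv_apply hf hg v).eq

theorem fderiv_fderiv_apply {f : E → ℝ} {p : E} (hf : IsSmoothGerm f p) (x y : E) :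
    fderiv ℝ (fderiv ℝ f) p x y = fderiv ℝ (fun q => fderiv ℝ f q y) p x := by
  have h1 : HasFDerivAt (fun q => fderiv ℝ f q y) _ p :=
    hf.fderiv_right.differentiableAt.hasFDerivAt.clm_apply (hasFDerivAt_const _ _)
  rw [h1.fderiv]
  simp

theorem fderiv_fderiv_symm {f : E → ℝ} {p : E} (hf : IsSmoothGerm f p) (x y : E) :
    fderiv ℝ (fderiv ℝ f) p x y = fderiv ℝ (fderiv ℝ f) p y x :=
  hf.contDiffAt.isSymmSndFDerivAt (by simp [ENat.LEInfty.out]) x y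

theorem IsSmoothGerm.fderiv_apply {f : E → ℝ} {p : E} (hf : IsSmoothGerm f p) (v : E) :
    IsSmoothGerm (fun x => fderiv ℝ f x v) p :=
  hf.fderiv_right.clm_apply (.of_contDiff contDiff_const _)

theorem SameJet.fderiv_fderiv_eq {k : ℕ} {f g : E → ℝ} {p : E} (h : SameJet (k + 2) f g p)
    (hf : IsSmoothGerm f p) (hg : IsSmoothGerm g p) :
    fderiv ℝ (fderiv ℝ f) p = fderiv ℝ (fderiv ℝ g) p := by
  ext x y
  rw [fderiv_fderiv_apply hf, fderiv_fderiv_apply hg,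
    (h.fderiv_apply hf hg y).fderiv_eq (hf.fderiv_apply y) (hg.fderiv_apply y)]

end Hessian

/-! ### Nondegenerate critical points are 2-determined -/

section Nondegenerate

variable {E : Type} [NormedAddCommGroup E] [NormedSpace ℝ E]

theorem GermEquiv.translate {F : Type*} [NormedAddCommGroup F] [NormedSpace ℝ F] (f : F → ℝ)
    (p : F) : GermEquiv f p (fun x => f (p + x)) 0 :=
  ⟨fun x => p + x, fun x => x - p, .of_contDiff (by fun_prop) _, .of_contDiff (by fun_prop) _,
    by simp, by simp, by simp, by simp, by simp⟩

/-- The Morse lemma. -/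
theorem germEquiv_of_nondegenerate [FiniteDimensional ℝ E] {f : E → ℝ} {p : E}
    (hf : IsSmoothGerm f p) (hcrit : fderiv ℝ f p = 0)
    (hinj : Function.Injective (fderiv ℝ (fderiv ℝ f) p)) :
    GermEquiv f p (fun x => f p + 2⁻¹ * fderiv ℝ (fderiv ℝ f) p x x) 0 := by
  have : CompleteSpace E := FiniteDimensional.complete ℝ E
  obtain ⟨A, hA⟩ := exists_continuousLinearEquiv_dual hinj
  -- The parametrized Morse lemma is used with a dummy parameter in `ℝ`, later set to `0`.
  let c : E × ℝ → E := fun q => p + q.1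
  have hc : ∀ q, HasFDerivAt c (ContinuousLinearMap.fst ℝ E ℝ) q := fun q =>
    hasFDerivAt_fst.const_add p
  have hcs : IsSmoothGerm c 0 := .of_contDiff (by fun_prop) _
  have hc0 : c 0 = p := by simp [c]
  have hf' : IsSmoothGerm f (c 0) := hc0.symm ▸ hf
  have hF : IsSmoothGerm (fun q => f (c q)) 0 := hf'.comp hcs
  have hy : ∀ y : E, ∀ᶠ q in 𝓝 (0 : E × ℝ), fderiv ℝ c q (y, 0) = y := fun y =>
    Eventually.of_forall fun q => by rw [(hc q).fderiv]; rfl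
  obtain ⟨R, hR, hR0, hFR⟩ := exists_morse hF
    (Eventually.of_forall fun t w => by
      have h1 : c (0, t) = p := by simp [c]
      have h2 : DifferentiableAt ℝ f (c (0, t)) := h1.symm ▸ hf.differentiableAt
      rw [fderiv_fun_comp _ h2 (hc _).differentiableAt, h1, hcrit]
      rfl) A
    (fun x y => by
      rw [fderiv_fderiv_comp_apply hf' hcs (hy y), (hc 0).fderiv, hc0, hA]
      rfl)
  refine (GermEquiv.translate f p).trans (GermEquiv.symm ?_)
  have hi : IsSmoothGerm (fun x : E => (x, (0 : ℝ))) 0 := .of_contDiff (by fun_prop) _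
  have hRi : IsSmoothGerm (fun x : E => R (x, 0)) 0 := hR.comp_of_eq hi rfl
  have hd : HasFDerivAt (fun x : E => R (x, 0) x)
      (ContinuousLinearEquiv.refl ℝ E : E →L[ℝ] E) 0 := by
    refine (hRi.differentiableAt.hasFDerivAt.clm_apply (hasFDerivAt_id (0 : E))).congr_fderiv
      (ContinuousLinearMap.ext fun x => ?_)
    simp only [Prod.mk_zero_zero, hR0]
    simp
  refine GermEquiv.of_hasFDerivAt (hRi.clm_apply (.of_contDiff contDiff_id _)) hd (by simp) ?_
  filter_upwards [(hi.tendsto (q := 0) rfl).eventually hFR] with x hx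
  simp only [c, hA, add_zero] at hx
  exact hx

theorem isDetermined_two_of_nondegenerate [FiniteDimensional ℝ E] {f : E → ℝ} {p : E}
    (hf : IsSmoothGerm f p) (hcrit : fderiv ℝ f p = 0)
    (hinj : Function.Injective (fderiv ℝ (fderiv ℝ f) p)) : IsDetermined 2 f p := by
  intro g hg hjet
  have h2 : fderiv ℝ (fderiv ℝ f) p = fderiv ℝ (fderiv ℝ g) p :=
    SameJet.fderiv_fderiv_eq (k := 0) hjet hf hg
  have h1 : fderiv ℝ f p = fderiv ℝ g p := SameJet.fderiv_eq (k := 1) hjet hf hg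
  have h3 := germEquiv_of_nondegenerate hg (h1 ▸ hcrit) (h2 ▸ hinj)
  rw [← h2, ← hjet.eq] at h3
  exact (germEquiv_of_nondegenerate hf hcrit hinj).trans h3.symm

theorem IsDetermined.mono {k l : ℕ} (hkl : k ≤ l) {f : E → ℝ} {p : E}
    (h : IsDetermined k f p) : IsDetermined l f p := fun g hg hjet => h g hg (hjet.mono hkl)

end Nondegenerate

/-! ### Degenerate critical points are not 2-determined -/

section Degenerate

variable {n : ℕ}

/-- The standard inner product of `Fin n → ℝ`, as a continuous bilinear form. -/
noncomputable def dotForm (n : ℕ) : (Fin n → ℝ) →L[ℝ] (Fin n → ℝ) →L[ℝ] ℝ :=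
  ∑ i, (ContinuousLinearMap.proj (R := ℝ) (φ := fun _ : Fin n => ℝ) i).smulRight
    (ContinuousLinearMap.proj (R := ℝ) (φ := fun _ : Fin n => ℝ) i)

theorem dotForm_apply (x y : Fin n → ℝ) : dotForm n x y = x ⬝ᵥ y := by
  simp [dotForm, dotProduct]

theorem not_isDetermined_two_of_degenerate {f : (Fin n → ℝ) → ℝ} {p : Fin n → ℝ}
    (hf : IsSmoothGerm f p) (hcrit : fderiv ℝ f p = 0) {v : Fin n → ℝ} (hv : v ≠ 0)
    (hker : fderiv ℝ (fderiv ℝ f) p v = 0) : ¬ IsDetermined 2 f p := by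
  intro hdet
  set D := fderiv ℝ (fderiv ℝ f) p with hD
  have hsymm : ∀ x y, D x y = D y x := fderiv_fderiv_symm hf
  -- All `G c` share the 2-jet of `f`: the added term is `c` times the fourth power of the Euclidean
  -- distance to `p`.
  let G : ℝ → (Fin n → ℝ) → ℝ := fun c x =>
    f p + 2⁻¹ * D (x - p) (x - p) + c * dotForm n (x - p) (x - p) ^ 2
  have hG : ∀ c, ContDiff ℝ ∞ (G c) := fun c => by
    simp only [G]
    fun_prop
  have hGd : ∀ c x, HasFDerivAt (G c)
      (D (x - p) + (4 * c * dotForm n (x - p) (x - p)) • dotForm n (x - p)) x := fun c x => by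
    have h0 : HasFDerivAt (fun x => x - p) (ContinuousLinearMap.id ℝ (Fin n → ℝ)) x :=
      (hasFDerivAt_id x).sub_const p
    have h1 : HasFDerivAt (fun x => D (x - p) (x - p)) _ x :=
      (D.hasFDerivAt.comp x h0).clm_apply h0
    have h2 : HasFDerivAt (fun x => dotForm n (x - p) (x - p)) _ x :=
      ((dotForm n).hasFDerivAt.comp x h0).clm_apply h0
    refine (((h1.const_mul 2⁻¹).const_add (f p)).add ((h2.pow 2).const_mul c)).congr_fderiv
      (ContinuousLinearMap.ext fun y => ?_)
    have h3 : dotForm n y (x - p) = dotForm n (x - p) y := by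
      rw [dotForm_apply, dotForm_apply, dotProduct_comm]
    simp [hsymm y, h3, -map_sub]
    ring
  have hGfd : ∀ c, fderiv ℝ (G c) =
      fun x => D (x - p) + (4 * c * dotForm n (x - p) (x - p)) • dotForm n (x - p) :=
    fun c => funext fun x => (hGd c x).fderiv
  have hGdd : ∀ c, fderiv ℝ (fderiv ℝ (G c)) p = D := fun c => by
    have h0 : HasFDerivAt (fun x => x - p) (ContinuousLinearMap.id ℝ (Fin n → ℝ)) p :=
      (hasFDerivAt_id p).sub_const p
    have h1 : HasFDerivAt (fun x => D (x - p)) _ p := D.hasFDerivAt.comp p h0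
    have h2 : HasFDerivAt (fun x => dotForm n (x - p)) _ p :=
      (dotForm n).hasFDerivAt.comp p h0
    have h3 : DifferentiableAt ℝ (fun x => 4 * c * dotForm n (x - p) (x - p)) p := by
      fun_prop
    have h4 : HasFDerivAt (fun x =>
        D (x - p) + (4 * c * dotForm n (x - p) (x - p)) • dotForm n (x - p)) _ p :=
      h1.add (h3.hasFDerivAt.smul h2)
    rw [hGfd, h4.fderiv]
    ext x y
    simp
  have key : ∀ c, GermEquiv f p (G c) p := fun c => by
    refine hdet _ (.of_contDiff (hG c) p) (sameJet_two ?_ ?_ (hGdd c).symm)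
    · simp [G]
    · rw [hcrit, hGfd]
      simp
  -- A critical point `p + y` of `G 1` satisfies `D y = -4 (y · y) y`, so `y ≠ 0` would give the
  -- eigenvalue `-4 (y · y)`. The nonzero eigenvalues are finitely many, hence bounded away from
  -- `0`, which excludes small `y`.
  have hiso : IsolatedCritical (G 1) p := by
    let T : Module.End ℝ (Fin n → ℝ) :=
      { toFun := fun x i => D x (Pi.single i 1)
        map_add' := fun x y => by ext; simp
        map_smul' := fun c x => by ext; simp }
    have hT : ∀ x, T x = fun i => D x (Pi.single i 1) := fun x => rfl
    have hfin : (spectrum ℝ T \ {0}).Finite := (Module.End.finite_spectrum T).subset Set.sdiff_subset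
    have hlim : Tendsto (fun x => -(4 * dotForm n (x - p) (x - p))) (𝓝 p) (𝓝 0) := by
      have h1 : Continuous fun x => -(4 * dotForm n (x - p) (x - p)) := by fun_prop
      exact h1.tendsto' _ _ (by simp)
    filter_upwards [hlim.eventually (hfin.isClosed.isOpen_compl.mem_nhds (by simp))] with x hx hx0
    by_contra hne
    have hne' : x - p ≠ 0 := sub_ne_zero.2 hne
    refine hx ⟨Module.End.HasEigenvalue.mem_spectrum
      (Module.End.hasEigenvalue_of_hasEigenvector (x := x - p) ⟨?_, hne'⟩), ?_⟩
    · rw [Module.End.mem_eigenspace_iff, hT]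
      ext i
      have h1 := DFunLike.congr_fun hx0 (Pi.single i 1)
      rw [(hGd 1 x).fderiv] at h1
      simp only [add_apply, smul_apply, smul_eq_mul, zero_apply, mul_one] at h1
      rw [dotForm_apply _ (Pi.single i 1), dotProduct_single_one] at h1
      rw [Pi.smul_apply, smul_eq_mul]
      linarith
    · rw [Set.mem_singleton_iff, neg_eq_zero, mul_eq_zero, not_or]
      exact ⟨four_ne_zero, by rwa [dotForm_apply, dotProduct_self_eq_zero]⟩
  have hiso0 : IsolatedCritical (G 0) p :=
    ((key 0).symm.trans (key 1)).isolatedCritical (.of_contDiff (hG 0) p) hiso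
  have hline : Tendsto (fun t : ℝ => p + t • v) (𝓝[≠] 0) (𝓝 p) := by
    have h1 : Continuous fun t : ℝ => p + t • v := by fun_prop
    exact (h1.tendsto' 0 p (by simp)).mono_left nhdsWithin_le_nhds
  have h1 : ∀ᶠ t in 𝓝[≠] (0 : ℝ), False := by
    filter_upwards [hline.eventually hiso0, self_mem_nhdsWithin] with t h2 h3
    have h4 := h2 (by rw [(hGd 0 _).fderiv]; simp [hker])
    rw [add_eq_left, smul_eq_zero] at h4
    exact h4.elim h3 hv
  simpa using h1.exists

end Degenerate

/-! ### Taylor expansion along a parabola -/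

section CurveExpansion

open Asymptotics

variable {E : Type*} [NormedAddCommGroup E] [NormedSpace ℝ E]

/-- The Taylor coefficients at `t = 0` of `g` along the curve `t ↦ P + t • v - (t ^ 2 / 2) • a`. -/
noncomputable def curveCoeff (v a P : E) : ℕ → (E → ℝ) → ℝ
  | 0, g => g P
  | 1, g => fderiv ℝ g P v
  | n + 2, g => (curveCoeff v a P (n + 1) (fun x => fderiv ℝ g x v) -
      curveCoeff v a P n (fun x => fderiv ℝ g x a)) / (n + 2)

theorem SameJet.curveCoeff_eq (v a P : E) : ∀ (n : ℕ) {f g : E → ℝ}, SameJet n f g P →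
    IsSmoothGerm f P → IsSmoothGerm g P → curveCoeff v a P n f = curveCoeff v a P n g
  | 0, _, _, h, _, _ => h.eq
  | 1, _, _, h, hf, hg => (h.fderiv_apply hf hg v).eq
  | n + 2, _, _, h, hf, hg => by
    rw [curveCoeff, curveCoeff,
      SameJet.curveCoeff_eq v a P (n + 1) (h.fderiv_apply hf hg v) (hf.fderiv_apply v)
        (hg.fderiv_apply v),
      SameJet.curveCoeff_eq v a P n ((h.fderiv_apply hf hg a).mono (Nat.le_succ n))
        (hf.fderiv_apply a) (hg.fderiv_apply a)]

theorem hasDerivAt_sum_pow (C : ℕ → ℝ) (n : ℕ) (t : ℝ) :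
    HasDerivAt (fun t : ℝ => ∑ i ∈ Finset.range (n + 1), C i * t ^ i)
      (∑ i ∈ Finset.range n, (i + 1) * C (i + 1) * t ^ i) t := by
  have h1 : HasDerivAt (fun t : ℝ => ∑ i ∈ Finset.range (n + 1), C i * t ^ i)
      (∑ i ∈ Finset.range (n + 1), C i * (i * t ^ (i - 1))) t :=
    HasDerivAt.fun_sum fun i _ => (hasDerivAt_pow i t).const_mul (C i)
  refine h1.congr_deriv ?_
  rw [Finset.sum_range_succ']
  simp only [CharP.cast_eq_zero, zero_mul, mul_zero, add_zero, Nat.add_sub_cancel, Nat.cast_add,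
    Nat.cast_one]
  exact Finset.sum_congr rfl fun i _ => by ring

theorem tendsto_curve (v a P : E) :
    Tendsto (fun t : ℝ => P + t • v - (t ^ 2 / 2) • a) (𝓝 0) (𝓝 P) := by
  have h : Continuous fun t : ℝ => P + t • v - (t ^ 2 / 2) • a := by fun_prop
  exact h.tendsto' _ _ (by simp)

theorem eventually_hasDerivAt_curve (v a : E) {P : E} {g : E → ℝ} (hg : IsSmoothGerm g P) :
    ∀ᶠ t in 𝓝 (0 : ℝ), HasDerivAt (fun t : ℝ => g (P + t • v - (t ^ 2 / 2) • a))
      (fderiv ℝ g (P + t • v - (t ^ 2 / 2) • a) v -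
        t * fderiv ℝ g (P + t • v - (t ^ 2 / 2) • a) a) t := by
  filter_upwards [(tendsto_curve v a P).eventually hg.eventually_differentiableAt] with t ht
  have h1 : HasDerivAt (fun t : ℝ => P + t • v - (t ^ 2 / 2) • a) (v - t • a) t := by
    have h2 := (((hasDerivAt_id t).smul_const v).const_add P).sub
      (((hasDerivAt_pow 2 t).div_const 2).smul_const a)
    refine h2.congr_deriv ?_
    simp
  refine (ht.hasFDerivAt.comp_hasDerivAt t h1).congr_deriv ?_
  simp

/-- The derivative of `g` along the curve is `D_v g - t D_a g`, evaluated on the curve. Comparing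
coefficients gives the recursion in `curveCoeff`, and the remainder estimate is integrated from the
estimates for `D_v g` and `D_a g`. -/
theorem isBigO_curve_sub_sum (v a P : E) : ∀ (n : ℕ) {g : E → ℝ}, IsSmoothGerm g P →
    (fun t : ℝ => g (P + t • v - (t ^ 2 / 2) • a) -
      ∑ i ∈ Finset.range n, curveCoeff v a P i g * t ^ i) =O[𝓝 0] fun t : ℝ => t ^ n
  | 0, g, hg => by
    simp only [Finset.range_zero, Finset.sum_empty, sub_zero, pow_zero]
    exact (hg.contDiffAt.continuousAt.tendsto.comp (tendsto_curve v a P)).isBigO_one ℝ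
  | 1, g, hg => by
    have h0 : ∀ u : E, (fun t : ℝ => fderiv ℝ g (P + t • v - (t ^ 2 / 2) • a) u)
        =O[𝓝 0] fun _ : ℝ => (1 : ℝ) := fun u =>
      ((hg.fderiv_apply u).contDiffAt.continuousAt.tendsto.comp (tendsto_curve v a P)).isBigO_one ℝ
    have ht : (fun t : ℝ => t) =O[𝓝 0] fun _ : ℝ => (1 : ℝ) := tendsto_id.isBigO_one ℝ
    refine isBigO_pow_succ_of_deriv (n := 0)
      (h' := fun t => fderiv ℝ g (P + t • v - (t ^ 2 / 2) • a) v -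
        t * fderiv ℝ g (P + t • v - (t ^ 2 / 2) • a) a) ?_ (by simp [curveCoeff]) ?_
    · filter_upwards [eventually_hasDerivAt_curve v a hg] with t ht
      simpa using ht.sub_const (curveCoeff v a P 0 g)
    · simpa using (h0 v).sub (by simpa using ht.mul (h0 a))
  | n + 2, g, hg => by
    have h1 := isBigO_curve_sub_sum v a P (n + 1) (hg.fderiv_apply v)
    have h2 := (isBigO_refl (fun t : ℝ => t) (𝓝 0)).mul
      (isBigO_curve_sub_sum v a P n (hg.fderiv_apply a))
    simp only [← pow_succ'] at h2
    refine isBigO_pow_succ_of_deriv (n := n + 1) (h' := fun t =>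
      (fderiv ℝ g (P + t • v - (t ^ 2 / 2) • a) v -
        t * fderiv ℝ g (P + t • v - (t ^ 2 / 2) • a) a) -
      ∑ i ∈ Finset.range (n + 1), (i + 1) * curveCoeff v a P (i + 1) g * t ^ i) ?_ ?_ ?_
    · filter_upwards [eventually_hasDerivAt_curve v a hg] with t ht
      exact ht.sub (hasDerivAt_sum_pow _ (n + 1) t)
    · rw [Finset.sum_range_succ']
      simp [curveCoeff]
    · refine (h1.sub h2).congr_left fun t => ?_
      rw [Finset.sum_range_succ' _ n, Finset.sum_range_succ' _ n, mul_sub, Finset.mul_sum]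
      have h3 : ∀ i ∈ Finset.range n,
          ((i + 1 : ℕ) + 1 : ℝ) * curveCoeff v a P (i + 1 + 1) g * t ^ (i + 1) =
          curveCoeff v a P (i + 1) (fun x => fderiv ℝ g x v) * t ^ (i + 1) -
            t * (curveCoeff v a P i (fun x => fderiv ℝ g x a) * t ^ i) := fun i _ => by
        rw [curveCoeff]
        have : (i : ℝ) + 2 ≠ 0 := by positivity
        push_cast
        field_simp
        ring
      rw [Finset.sum_congr rfl h3, Finset.sum_sub_distrib]
      simp only [curveCoeff, CharP.cast_eq_zero]
      ring

end CurveExpansion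

/-! ### Reduction of corank one to one variable -/

section Reduction

open Asymptotics

variable {E : Type} [NormedAddCommGroup E] [NormedSpace ℝ E] {m : ℕ}

/-- In the linear coordinates `L` on the source, the critical point `P` of `f` is nondegenerate
with Hessian `A` along `Fin m → ℝ`, the remaining direction `v = L (0, 1)` is in the kernel of the
Hessian, and the curve `P + t • v - (t ^ 2 / 2) • L (a, 0)` follows to second order the critical
points of the restrictions of `f` to the fibres of `L`. -/
structure IsAdapted (L : ((Fin m → ℝ) × ℝ) ≃L[ℝ] E)
    (A : (Fin m → ℝ) ≃L[ℝ] ((Fin m → ℝ) →L[ℝ] ℝ)) (a : Fin m → ℝ) (f : E → ℝ) (P : E) : Prop where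
  smooth : IsSmoothGerm f P
  crit : fderiv ℝ f P = 0
  kernel : fderiv ℝ (fderiv ℝ f) P (L (0, 1)) = 0
  hessian : ∀ x y, fderiv ℝ (fderiv ℝ f) P (L (x, 0)) (L (y, 0)) = A x y
  section_eq : ∀ y, curveCoeff (L (0, 1)) (L (a, 0)) P 2 (fun x => fderiv ℝ f x (L (y, 0))) = 0

variable {L : ((Fin m → ℝ) × ℝ) ≃L[ℝ] E} {A : (Fin m → ℝ) ≃L[ℝ] ((Fin m → ℝ) →L[ℝ] ℝ)}
  {a : Fin m → ℝ} {f : E → ℝ} {P : E}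

/-- The condition `section_eq` involves derivatives of order three and the others lower ones, so
being adapted is a property of the 3-jet. -/
theorem IsAdapted.of_sameJet (h : IsAdapted L A a f P) {g : E → ℝ} (hg : IsSmoothGerm g P)
    {k : ℕ} (hk : 3 ≤ k) (hjet : SameJet k f g P) : IsAdapted L A a g P := by
  have h3 : SameJet 3 f g P := hjet.mono hk
  have h1 : fderiv ℝ f P = fderiv ℝ g P := SameJet.fderiv_eq (k := 2) h3 h.smooth hg
  have h2 : fderiv ℝ (fderiv ℝ f) P = fderiv ℝ (fderiv ℝ g) P :=
    SameJet.fderiv_fderiv_eq (k := 1) h3 h.smooth hg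
  refine ⟨hg, h1 ▸ h.crit, h2 ▸ h.kernel, h2 ▸ h.hessian, fun y => ?_⟩
  exact (SameJet.curveCoeff_eq _ _ P 2 (SameJet.fderiv_apply (k := 2) h3 h.smooth hg _)
    (h.smooth.fderiv_apply _) (hg.fderiv_apply _)).symm.trans (h.section_eq y)

theorem IsAdapted.symm_apply (h : IsAdapted L A a f P) (x y : Fin m → ℝ) : A x y = A y x := by
  rw [← h.hessian, ← h.hessian, fderiv_fderiv_symm h.smooth]

theorem clm_eq_sum_smul_proj (ℓ : (Fin m → ℝ) →L[ℝ] ℝ) :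
    ℓ = ∑ i, ℓ (Pi.single i 1) • ContinuousLinearMap.proj (R := ℝ) (φ := fun _ => ℝ) i := by
  refine ContinuousLinearMap.ext fun x => ?_
  conv_lhs => rw [pi_eq_sum_univ' x]
  simp [mul_comm]

theorem IsAdapted.exists_splitting (h : IsAdapted L A a f P) :
    ∃ r : ℝ → ℝ, IsSmoothGerm r 0 ∧
      GermEquiv f P (fun p => r p.2 + 2⁻¹ * A p.1 p.1) (0 : (Fin m → ℝ) × ℝ) ∧
      ∀ n ≤ 6, (fun t => r t - ∑ i ∈ Finset.range n,
        curveCoeff (L (0, 1)) (L (a, 0)) P i f * t ^ i) =O[𝓝 0] fun t : ℝ => t ^ n := by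
  let c : (Fin m → ℝ) × ℝ → E := fun q => P + L q - (q.2 ^ 2 / 2) • L (a, 0)
  have hcd : ∀ q, HasFDerivAt c ((L : (Fin m → ℝ) × ℝ →L[ℝ] E) -
      (q.2 • ContinuousLinearMap.snd ℝ (Fin m → ℝ) ℝ).smulRight (L (a, 0))) q := fun q => by
    have h1 := (L.hasFDerivAt (x := q)).const_add P |>.sub
      ((((hasFDerivAt_snd (𝕜 := ℝ) (p := q)).pow 2).mul_const (2⁻¹ : ℝ)).smul_const (L (a, 0)))
    simp only [← div_eq_mul_inv] at h1
    refine h1.congr_fderiv (ContinuousLinearMap.ext fun x => ?_)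
    simp [mul_assoc]
  have hcs : IsSmoothGerm c 0 := .of_contDiff (by fun_prop) _
  have hc0 : c 0 = P := by simp [c]
  have hcd0 : HasFDerivAt c (L : (Fin m → ℝ) × ℝ →L[ℝ] E) 0 :=
    (hcd 0).congr_fderiv (ContinuousLinearMap.ext fun x => by simp)
  have hcy : ∀ q y, fderiv ℝ c q (y, 0) = L (y, 0) := fun q y => by
    rw [(hcd q).fderiv]
    simp
  have hline : ∀ t : ℝ, c (0, t) = P + t • L (0, 1) - (t ^ 2 / 2) • L (a, 0) := fun t => by
    have h1 : L (0, t) = t • L (0, 1) := by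
      rw [← map_smul]
      simp
    simp only [c, h1]
  have hfc : IsSmoothGerm f (c 0) := hc0.symm ▸ h.smooth
  have hF : IsSmoothGerm (fun q => f (c q)) 0 := hfc.comp hcs
  obtain ⟨r, hr, hrF, hrO⟩ := Determinacy.exists_splitting hF A
    (fun w => by
      rw [(eventually_fderiv_comp_apply hfc hcs
        (Eventually.of_forall fun q => hcy q w)).self_of_nhds, hc0, h.crit]
      rfl)
    (fun x s y => by
      rw [fderiv_fderiv_comp_apply hfc hcs (Eventually.of_forall fun q => hcy q y), hcd0.fderiv,
        hc0]
      have h1 : L (x, s) = L (x, 0) + s • L (0, 1) := by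
        rw [← map_smul, ← map_add]
        simp
      change fderiv ℝ (fderiv ℝ f) P (L (x, s)) (L (y, 0)) = _
      rw [h1, map_add, map_smul, h.kernel, smul_zero, add_zero, h.hessian])
  -- The coefficients of orders 0, 1 and 2 of the fibre derivative vanish by `crit`, `kernel` and
  -- `section_eq` respectively.
  have hDO : (fun t : ℝ => (fderiv ℝ (fun q => f (c q)) (0, t)).comp
      (ContinuousLinearMap.inl ℝ (Fin m → ℝ) ℝ)) =O[𝓝 0] fun t : ℝ => t ^ 3 := by
    have h1 : ∀ i : Fin m, (fun t : ℝ => fderiv ℝ (fun q => f (c q)) (0, t) (Pi.single i 1, 0))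
        =O[𝓝 0] fun t : ℝ => t ^ 3 := fun i => by
      have h2 := isBigO_curve_sub_sum (L (0, 1)) (L (a, 0)) P 3
        (h.smooth.fderiv_apply (L (Pi.single i 1, 0)))
      have h3 : curveCoeff (L (0, 1)) (L (a, 0)) P 0
          (fun x => fderiv ℝ f x (L (Pi.single i 1, 0))) = 0 := by
        simp [curveCoeff, h.crit]
      have h4 : curveCoeff (L (0, 1)) (L (a, 0)) P 1
          (fun x => fderiv ℝ f x (L (Pi.single i 1, 0))) = 0 := by
        rw [curveCoeff, ← fderiv_fderiv_apply h.smooth, h.kernel]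
        rfl
      simp only [Finset.sum_range_succ, Finset.sum_range_zero, h3, h4, h.section_eq, zero_mul,
        add_zero, sub_zero] at h2
      refine h2.congr' ?_ .rfl
      filter_upwards [tendsto_inr.eventually (eventually_fderiv_comp_apply hfc hcs
        (Eventually.of_forall fun q => hcy q (Pi.single i 1)))] with t ht
      rw [ht, hline]
    have h2 : ∀ t : ℝ, (fderiv ℝ (fun q => f (c q)) (0, t)).comp
        (ContinuousLinearMap.inl ℝ (Fin m → ℝ) ℝ) =
        ∑ i, fderiv ℝ (fun q => f (c q)) (0, t) (Pi.single i 1, 0) •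
          ContinuousLinearMap.proj (R := ℝ) (φ := fun _ => ℝ) i := fun t =>
      clm_eq_sum_smul_proj _
    simp only [h2]
    refine IsBigO.fun_sum fun i _ => ?_
    have h3 := (h1 i).smul (isBigO_refl (fun _ : ℝ =>
      (ContinuousLinearMap.proj (R := ℝ) (φ := fun _ : Fin m => ℝ) i :
        (Fin m → ℝ) →L[ℝ] ℝ)) (𝓝 0))
    refine h3.trans (IsBigO.of_bound
      ‖(ContinuousLinearMap.proj (R := ℝ) (φ := fun _ : Fin m => ℝ) i :
        (Fin m → ℝ) →L[ℝ] ℝ)‖ (Eventually.of_forall fun t => ?_))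
    rw [norm_smul, mul_comm]
  -- The splitting error is quadratic in the fibre derivative, so `t ^ 3` becomes `t ^ 6`:
  -- coefficients of `r` up to order 5 can be read along the parabola.
  have h6 : (fun t : ℝ => f (c (0, t)) - r t) =O[𝓝 0] fun t : ℝ => t ^ 6 := by
    refine hrO.trans ((hDO.norm_left.pow 2).congr_right fun t => ?_)
    rw [← pow_mul]
  refine ⟨r, hr, (GermEquiv.of_hasFDerivAt hcs hcd0 hc0 (Eventually.of_forall fun _ => rfl)).trans hrF, fun n hn => ?_⟩
  have h7 : (fun t : ℝ => t ^ 6) =O[𝓝 0] fun t : ℝ => t ^ n := by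
    obtain ⟨l, hl⟩ := Nat.exists_eq_add_of_le hn
    simp only [hl, pow_add]
    have h8 : (fun t : ℝ => t ^ l) =O[𝓝 0] fun _ : ℝ => (1 : ℝ) :=
      (by fun_prop : Continuous fun t : ℝ => t ^ l).tendsto 0 |>.isBigO_one ℝ
    simpa using (isBigO_refl (fun t : ℝ => t ^ n) (𝓝 0)).mul h8
  have h9 := (isBigO_curve_sub_sum (L (0, 1)) (L (a, 0)) P n h.smooth).sub (h6.trans h7)
  refine h9.congr_left fun t => ?_
  rw [hline]
  ring

theorem sum_range_eq_zero_term {C : ℕ → ℝ} {k : ℕ} (hk : k ≠ 0)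
    (hC : ∀ i, 0 < i → i < k → C i = 0) (t : ℝ) :
    ∑ i ∈ Finset.range k, C i * t ^ i = C 0 := by
  obtain ⟨l, rfl⟩ := Nat.exists_eq_succ_of_ne_zero hk
  rw [Finset.sum_range_succ', Finset.sum_eq_zero fun i hi => ?_]
  · simp
  · rw [hC (i + 1) (Nat.succ_pos i) (by simpa using hi), zero_mul]

theorem IsAdapted.germEquiv_normalForm (h : IsAdapted L A a f P) {k : ℕ} (hk : k ≠ 0)
    (hk5 : k ≤ 5) (hC : ∀ i, 0 < i → i < k → curveCoeff (L (0, 1)) (L (a, 0)) P i f = 0)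
    (hCk : curveCoeff (L (0, 1)) (L (a, 0)) P k f ≠ 0) :
    GermEquiv f P (fun p : (Fin m → ℝ) × ℝ => f P +
      curveCoeff (L (0, 1)) (L (a, 0)) P k f * p.2 ^ k + 2⁻¹ * A p.1 p.1) 0 := by
  obtain ⟨r, hr, hfr, hrO⟩ := h.exists_splitting
  refine hfr.trans (GermEquiv.of_leading_term (fun w => 2⁻¹ * A w w) hr hCk hk ?_).symm
  refine (hrO (k + 1) (by omega)).congr_left fun t => ?_
  rw [Finset.sum_range_succ, sum_range_eq_zero_term hk hC]
  rfl

theorem IsAdapted.isDetermined (h : IsAdapted L A a f P) {k : ℕ} (hk3 : 3 ≤ k) (hk5 : k ≤ 5)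
    (hC : ∀ i, 0 < i → i < k → curveCoeff (L (0, 1)) (L (a, 0)) P i f = 0)
    (hCk : curveCoeff (L (0, 1)) (L (a, 0)) P k f ≠ 0) : IsDetermined k f P := by
  intro g hg hjet
  have hgf : ∀ i ≤ k, curveCoeff (L (0, 1)) (L (a, 0)) P i f =
      curveCoeff (L (0, 1)) (L (a, 0)) P i g := fun i hi =>
    (hjet.mono hi).curveCoeff_eq _ _ P i h.smooth hg
  have h1 := (h.of_sameJet hg hk3 hjet).germEquiv_normalForm (by omega) hk5
    (fun i h0 hi => by rw [← hgf i hi.le, hC i h0 hi]) (by rwa [← hgf k le_rfl])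
  rw [← hgf k le_rfl, ← hjet.eq] at h1
  exact (h.germEquiv_normalForm (by omega) hk5 hC hCk).trans h1.symm

theorem IsAdapted.not_isDetermined (h : IsAdapted L A a f P) {k : ℕ} (hk5 : k ≤ 5)
    (hC : ∀ i, 0 < i → i ≤ k → curveCoeff (L (0, 1)) (L (a, 0)) P i f = 0) :
    ¬ IsDetermined k f P := by
  obtain ⟨r, hr, hfr, hrO⟩ := h.exists_splitting
  refine not_isDetermined_of_germEquiv (A : (Fin m → ℝ) →L[ℝ] (Fin m → ℝ) →L[ℝ] ℝ)
    h.symm_apply A.injective hr hk5 (c₀ := f P) ?_ hfr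
  refine (hrO (k + 1) (by omega)).congr_left fun t => ?_
  rw [sum_range_eq_zero_term (by omega) fun i h0 hi => hC i h0 (by omega)]
  rfl

end Reduction

/-! ### Directional derivatives -/

section DirectionalDerivatives

variable {E : Type*} [NormedAddCommGroup E] [NormedSpace ℝ E]

/-- The derivative of `f` in the direction `v`. -/
noncomputable abbrev dirDeriv (v : E) (f : E → ℝ) : E → ℝ := fun x => fderiv ℝ f x v

theorem dirDeriv_congr (v : E) {f g : E → ℝ} {p : E} (h : f =ᶠ[𝓝 p] g) :
    dirDeriv v f =ᶠ[𝓝 p] dirDeriv v g := by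
  filter_upwards [h.fderiv (𝕜 := ℝ)] with x hx
  rw [dirDeriv, dirDeriv, hx]

theorem dirDeriv_comm (v w : E) {f : E → ℝ} {p : E} (hf : IsSmoothGerm f p) :
    dirDeriv v (dirDeriv w f) =ᶠ[𝓝 p] dirDeriv w (dirDeriv v f) := by
  filter_upwards [eventually_eventually_nhds.2 hf] with x hx
  have hx' : IsSmoothGerm f x := hx
  rw [dirDeriv, dirDeriv, ← fderiv_fderiv_apply hx', fderiv_fderiv_symm hx',
    fderiv_fderiv_apply hx']

/-- Four terms suffice because a third derivative in the `z, w` plane has four kinds of mixed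
partials. Shorter combinations are padded with zero coefficients. -/
theorem dirDeriv_linear_combination (v : E) {p : E} {g h₁ h₂ h₃ h₄ : E → ℝ} {c₁ c₂ c₃ c₄ : ℝ}
    (H₁ : IsSmoothGerm h₁ p) (H₂ : IsSmoothGerm h₂ p) (H₃ : IsSmoothGerm h₃ p)
    (H₄ : IsSmoothGerm h₄ p)
    (hg : g =ᶠ[𝓝 p] fun x => c₁ * h₁ x + c₂ * h₂ x + c₃ * h₃ x + c₄ * h₄ x) :
    dirDeriv v g =ᶠ[𝓝 p] fun x => c₁ * dirDeriv v h₁ x + c₂ * dirDeriv v h₂ x +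
      c₃ * dirDeriv v h₃ x + c₄ * dirDeriv v h₄ x := by
  refine (dirDeriv_congr v hg).trans ?_
  filter_upwards [H₁.eventually_differentiableAt, H₂.eventually_differentiableAt,
    H₃.eventually_differentiableAt, H₄.eventually_differentiableAt] with x d₁ d₂ d₃ d₄
  have h : HasFDerivAt (fun x => c₁ * h₁ x + c₂ * h₂ x + c₃ * h₃ x + c₄ * h₄ x) _ x :=
    (((d₁.hasFDerivAt.const_mul c₁).add (d₂.hasFDerivAt.const_mul c₂)).add
      (d₃.hasFDerivAt.const_mul c₃)).add (d₄.hasFDerivAt.const_mul c₄)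
  rw [dirDeriv, h.fderiv]
  simp

end DirectionalDerivatives

/-! ### Coordinates adapted to the null direction -/

section Coordinates

/-- The linear coordinates `(w, t) ↦ (w₀, w₁, w₂ - s t, t)`. -/
noncomputable def shearCoords (s : ℝ) : ((Fin 3 → ℝ) × ℝ) ≃L[ℝ] (Fin 4 → ℝ) :=
  LinearEquiv.toContinuousLinearEquiv
    { toFun := fun q => ![q.1 0, q.1 1, q.1 2 - s * q.2, q.2]
      invFun := fun x => (![x 0, x 1, x 2 + s * x 3], x 3)
      map_add' := fun q r => by
        ext i
        fin_cases i <;> simp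
        ring
      map_smul' := fun c q => by
        ext i
        fin_cases i <;> simp
        ring
      left_inv := fun q => by
        refine Prod.ext (funext fun i => ?_) rfl
        fin_cases i <;> simp
      right_inv := fun x => by
        ext i
        fin_cases i <;> simp }

theorem shearCoords_apply (s : ℝ) (q : (Fin 3 → ℝ) × ℝ) :
    shearCoords s q = ![q.1 0, q.1 1, q.1 2 - s * q.2, q.2] := rfl

theorem dirDeriv_shear_snd (s : ℝ) (g : (Fin 4 → ℝ) → ℝ) (x : Fin 4 → ℝ) :
    dirDeriv (shearCoords s (0, 1)) g x = -s * pd 2 g x + pd 3 g x := by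
  have h : shearCoords s (0, 1) =
      (-s) • (Pi.single 2 1 : Fin 4 → ℝ) + Pi.single 3 1 := by
    rw [shearCoords_apply]
    ext i
    fin_cases i <;> simp
  rw [dirDeriv, h]
  simp [pd]

theorem dirDeriv_shear_fst (s : ℝ) (y : Fin 3 → ℝ) (g : (Fin 4 → ℝ) → ℝ) (x : Fin 4 → ℝ) :
    dirDeriv (shearCoords s (y, 0)) g x = ∑ u : Fin 3, y u * pd u.castSucc g x := by
  have h : shearCoords s (y, 0) =
      ∑ u : Fin 3, y u • (Pi.single u.castSucc 1 : Fin 4 → ℝ) := by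
    rw [shearCoords_apply]
    ext i
    fin_cases i <;> simp [Fin.sum_univ_three, Pi.single_apply]
  rw [dirDeriv, h]
  simp [pd]

variable {V : (Fin 4 → ℝ) → ℝ} {P : Fin 4 → ℝ}

theorem IsSmoothGerm.pd (hV : IsSmoothGerm V P) (i : Fin 4) : IsSmoothGerm (pd i V) P :=
  hV.fderiv_apply _

theorem pd_comm (hV : IsSmoothGerm V P) (i j : Fin 4) :
    pd i (pd j V) =ᶠ[𝓝 P] pd j (pd i V) := dirDeriv_comm _ _ hV

theorem hessian_apply (hV : IsSmoothGerm V P) (i j : Fin 4) :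
    hessian V P i j = fderiv ℝ (fderiv ℝ V) P (Pi.single i 1) (Pi.single j 1) :=
  (fderiv_fderiv_apply hV _ _).symm

theorem hessian_symm (hV : IsSmoothGerm V P) (i j : Fin 4) :
    hessian V P i j = hessian V P j i := by
  rw [hessian_apply hV, hessian_apply hV, fderiv_fderiv_symm hV]

theorem fderiv_fderiv_eq_dotProduct (hV : IsSmoothGerm V P) (x y : Fin 4 → ℝ) :
    fderiv ℝ (fderiv ℝ V) P x y = x ⬝ᵥ (hessian V P).mulVec y := by
  conv_lhs => rw [pi_eq_sum_univ' x, pi_eq_sum_univ' y]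
  simp only [map_sum, map_smul, sum_apply, smul_apply, smul_eq_mul, dotProduct, Matrix.mulVec,
    hessian_apply hV, Finset.mul_sum]
  rw [Finset.sum_comm]
  exact Finset.sum_congr rfl fun i _ => Finset.sum_congr rfl fun j _ => by ring

theorem dirDeriv_dirDeriv_shear (hV : IsSmoothGerm V P) (s : ℝ) :
    dirDeriv (shearCoords s (0, 1)) (dirDeriv (shearCoords s (0, 1)) V) =ᶠ[𝓝 P]
      fun x => s ^ 2 * pd 2 (pd 2 V) x + (-2 * s) * pd 2 (pd 3 V) x + 1 * pd 3 (pd 3 V) x +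
        0 * pd 3 (pd 3 V) x := by
  have h1 : dirDeriv (shearCoords s (0, 1)) V =ᶠ[𝓝 P]
      fun x => -s * pd 2 V x + 1 * pd 3 V x + 0 * pd 3 V x + 0 * pd 3 V x :=
    Eventually.of_forall fun x => by
      simp only [dirDeriv_shear_snd]
      ring
  filter_upwards [dirDeriv_linear_combination (Pi.single 2 1) (hV.pd 2) (hV.pd 3) (hV.pd 3)
      (hV.pd 3) h1, dirDeriv_linear_combination (Pi.single 3 1) (hV.pd 2) (hV.pd 3) (hV.pd 3)
      (hV.pd 3) h1, pd_comm hV 3 2] with x h2 h3 h4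
  simp only [dirDeriv_shear_snd s (dirDeriv (shearCoords s (0, 1)) V)]
  simp only [pd] at h2 h3 h4 ⊢
  simp only [dirDeriv] at h2 h3 h4 ⊢
  rw [h2, h3, h4]
  ring

theorem dirDeriv_shear_three (hV : IsSmoothGerm V P) (s : ℝ) :
    dirDeriv (shearCoords s (0, 1)) (dirDeriv (shearCoords s (0, 1))
      (dirDeriv (shearCoords s (0, 1)) V)) =ᶠ[𝓝 P]
      fun x => -s ^ 3 * pd 2 (pd 2 (pd 2 V)) x + (3 * s ^ 2) * pd 2 (pd 2 (pd 3 V)) x +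
        (-3 * s) * pd 2 (pd 3 (pd 3 V)) x + 1 * pd 3 (pd 3 (pd 3 V)) x := by
  have h1 := dirDeriv_dirDeriv_shear hV s
  have s22 := (hV.pd 2).pd 2
  have s23 := (hV.pd 3).pd 2
  have s33 := (hV.pd 3).pd 3
  filter_upwards [dirDeriv_linear_combination (Pi.single 2 1) s22 s23 s33 s33 h1,
    dirDeriv_linear_combination (Pi.single 3 1) s22 s23 s33 s33 h1, pd_comm (hV.pd 2) 3 2,
    dirDeriv_congr (Pi.single 2 1) (pd_comm hV 3 2), pd_comm (hV.pd 3) 3 2] with x h2 h3 h4 h5 h6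
  simp only [dirDeriv_shear_snd s (dirDeriv (shearCoords s (0, 1)) (dirDeriv _ V))]
  simp only [pd] at h2 h3 h4 h5 h6 ⊢
  simp only [dirDeriv] at h2 h3 h4 h5 h6 ⊢
  rw [h2, h3, h4, h5, h6]
  ring

theorem dirDeriv_shear_four (hV : IsSmoothGerm V P) (s : ℝ) :
    dirDeriv (shearCoords s (0, 1)) (dirDeriv (shearCoords s (0, 1))
      (dirDeriv (shearCoords s (0, 1)) (dirDeriv (shearCoords s (0, 1)) V))) P =
      s ^ 4 * pd 2 (pd 2 (pd 2 (pd 2 V))) P - 4 * s ^ 3 * pd 2 (pd 2 (pd 2 (pd 3 V))) P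
        + 6 * s ^ 2 * pd 2 (pd 2 (pd 3 (pd 3 V))) P
        - 4 * s * pd 2 (pd 3 (pd 3 (pd 3 V))) P + pd 3 (pd 3 (pd 3 (pd 3 V))) P := by
  have h1 := dirDeriv_shear_three hV s
  have s1 := ((hV.pd 2).pd 2).pd 2
  have s2 := ((hV.pd 3).pd 2).pd 2
  have s3 := ((hV.pd 3).pd 3).pd 2
  have s4 := ((hV.pd 3).pd 3).pd 3
  have h2 := (dirDeriv_linear_combination (Pi.single 2 1) s1 s2 s3 s4 h1).self_of_nhds
  have h3 := (dirDeriv_linear_combination (Pi.single 3 1) s1 s2 s3 s4 h1).self_of_nhds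
  have e1 : pd 3 (pd 2 (pd 2 (pd 2 V))) P = pd 2 (pd 2 (pd 2 (pd 3 V))) P :=
    ((pd_comm ((hV.pd 2).pd 2) 3 2).trans (dirDeriv_congr _ ((pd_comm (hV.pd 2) 3 2).trans
      (dirDeriv_congr _ (pd_comm hV 3 2))))).self_of_nhds
  have e2 : pd 3 (pd 2 (pd 2 (pd 3 V))) P = pd 2 (pd 2 (pd 3 (pd 3 V))) P :=
    ((pd_comm ((hV.pd 3).pd 2) 3 2).trans
      (dirDeriv_congr _ (pd_comm (hV.pd 3) 3 2))).self_of_nhds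
  have e3 : pd 3 (pd 2 (pd 3 (pd 3 V))) P = pd 2 (pd 3 (pd 3 (pd 3 V))) P :=
    (pd_comm ((hV.pd 3).pd 3) 3 2).self_of_nhds
  rw [dirDeriv_shear_snd s (dirDeriv _ (dirDeriv _ (dirDeriv _ V)))]
  change pd 2 _ P = _ at h2
  change pd 3 _ P = _ at h3
  rw [h2, h3]
  change -s * (-s ^ 3 * pd 2 (pd 2 (pd 2 (pd 2 V))) P + (3 * s ^ 2) *
    pd 2 (pd 2 (pd 2 (pd 3 V))) P + (-3 * s) * pd 2 (pd 2 (pd 3 (pd 3 V))) P +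
    1 * pd 2 (pd 3 (pd 3 (pd 3 V))) P) + (-s ^ 3 * pd 3 (pd 2 (pd 2 (pd 2 V))) P +
    (3 * s ^ 2) * pd 3 (pd 2 (pd 2 (pd 3 V))) P + (-3 * s) * pd 3 (pd 2 (pd 3 (pd 3 V))) P +
    1 * pd 3 (pd 3 (pd 3 (pd 3 V))) P) = _
  rw [e1, e2, e3]
  ring

/-- `D³V` is minus the third derivative of `V` along `(0, 0, -α, 1)`. -/
theorem dirDeriv_three_eq (hV : IsSmoothGerm V P) :
    dirDeriv (shearCoords (α V P) (0, 1)) (dirDeriv (shearCoords (α V P) (0, 1))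
      (dirDeriv (shearCoords (α V P) (0, 1)) V)) P = -D3 V P := by
  rw [(dirDeriv_shear_three hV (α V P)).self_of_nhds, D3]
  ring

theorem dirDeriv_fst_snd_snd (hV : IsSmoothGerm V P) (y : Fin 3 → ℝ) :
    dirDeriv (shearCoords (α V P) (y, 0)) (dirDeriv (shearCoords (α V P) (0, 1))
      (dirDeriv (shearCoords (α V P) (0, 1)) V)) P = y ⬝ᵥ κ V P := by
  rw [dirDeriv_shear_fst _ y, dotProduct]
  refine Finset.sum_congr rfl fun u _ => ?_
  congr 1
  have h1 := (dirDeriv_linear_combination (Pi.single u.castSucc 1) ((hV.pd 2).pd 2)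
    ((hV.pd 3).pd 2) ((hV.pd 3).pd 3) ((hV.pd 3).pd 3)
    (dirDeriv_dirDeriv_shear hV (α V P))).self_of_nhds
  refine h1.trans ?_
  simp only [κ, pd]
  ring

end Coordinates

/-! ### The corank-one case -/

section CorankOne

variable {V : (Fin 4 → ℝ) → ℝ} {P : Fin 4 → ℝ}

/-- The `z`-row of the null equation reads `V_zz v₃ + V_zw v₄ = 0`. Hence `v₄ ≠ 0`, and the null
vector is a multiple of `(0, 0, -α, 1)`. -/
theorem HasCorankOneZW.mulVec_shearCoords (h : HasCorankOneZW V P)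
    (hz : pd 2 (pd 2 V) P ≠ 0) : (hessian V P).mulVec (shearCoords (α V P) (0, 1)) = 0 := by
  obtain ⟨-, v₃, v₄, hne, hv⟩ := h
  have h2 : pd 2 (pd 2 V) P * v₃ + pd 2 (pd 3 V) P * v₄ = 0 := by
    have := congrFun hv 2
    simpa [Matrix.mulVec, dotProduct, Fin.sum_univ_four, hessian] using this
  have h4 : v₄ ≠ 0 := fun h4 => by
    rw [h4, mul_zero, add_zero] at h2
    exact hne ⟨(mul_eq_zero.1 h2).resolve_left hz, h4⟩
  have h3 : v₃ = -α V P * v₄ := by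
    rw [α]
    field_simp
    linarith
  have h5 : shearCoords (α V P) (0, 1) = v₄⁻¹ • ![0, 0, v₃, v₄] := by
    rw [shearCoords_apply, h3]
    ext i
    fin_cases i <;> simp
    · field_simp
    · field_simp
  rw [h5, Matrix.mulVec_smul, hv, smul_zero]

theorem dotProduct_shear_fst (s : ℝ) (x y : Fin 3 → ℝ) :
    shearCoords s (x, 0) ⬝ᵥ (hessian V P).mulVec (shearCoords s (y, 0)) =
      x ⬝ᵥ (hessianXYZ V P).mulVec y := by
  simp [shearCoords_apply, dotProduct, Matrix.mulVec, Fin.sum_univ_four, Fin.sum_univ_three,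
    hessianXYZ]

theorem hessianXYZ_isSymm (hV : IsSmoothGerm V P) : (hessianXYZ V P).transpose = hessianXYZ V P := by
  ext i j
  exact hessian_symm hV _ _

/-- A null vector of the block, extended by a zero `w`-coordinate, is orthogonal for the Hessian to
the `x, y, z` directions and to `v`, so it lies in the kernel. It is then a multiple of `v`, whose
`w`-coordinate is 1, and therefore vanishes. -/
theorem HasCorankOneZW.det_hessianXYZ_ne_zero (hV : IsSmoothGerm V P) (h : HasCorankOneZW V P)
    (hz : pd 2 (pd 2 V) P ≠ 0) : (hessianXYZ V P).det ≠ 0 := by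
  intro hdet
  have hv := h.mulVec_shearCoords hz
  obtain ⟨x, hx0, hx⟩ := Matrix.exists_mulVec_eq_zero_iff.2 hdet
  set v := shearCoords (α V P) (0, 1)
  set y := shearCoords (α V P) (x, 0)
  have hy : (hessian V P).mulVec y = 0 := by
    have h1 : ∀ u : Fin 3 → ℝ,
        shearCoords (α V P) (u, 0) ⬝ᵥ (hessian V P).mulVec y = 0 := fun u => by
      rw [dotProduct_shear_fst, hx, dotProduct_zero]
    have h2 : v ⬝ᵥ (hessian V P).mulVec y = 0 := by
      rw [← fderiv_fderiv_eq_dotProduct hV, fderiv_fderiv_symm hV,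
        fderiv_fderiv_eq_dotProduct hV, hv, dotProduct_zero]
    refine dotProduct_eq_zero _ fun z => ?_
    obtain ⟨⟨u, t⟩, rfl⟩ := (shearCoords (α V P)).surjective z
    have h3 : shearCoords (α V P) (u, t) = shearCoords (α V P) (u, 0) + t • v := by
      rw [← map_smul, ← map_add]
      simp
    rw [dotProduct_comm, h3, add_dotProduct, smul_dotProduct, h1, h2, smul_zero, add_zero]
  have hvne : v ≠ 0 := fun h0 => by
    simpa [v, shearCoords_apply] using congrFun h0 3
  obtain ⟨c, hc⟩ := (finrank_eq_one_iff_of_nonzero'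
    (⟨v, hv⟩ : LinearMap.ker (hessian V P).mulVecLin)
    (fun h0 => hvne (congrArg Subtype.val h0))).1 h.1 ⟨y, hy⟩
  have hcy : c • v = y := congrArg Subtype.val hc
  have hc0 : c = 0 := by
    simpa [v, y, shearCoords_apply] using congrFun hcy 3
  rw [hc0, zero_smul] at hcy
  have h4 : ((x, 0) : (Fin 3 → ℝ) × ℝ) = 0 :=
    (shearCoords (α V P)).injective (hcy.symm.trans (map_zero _).symm)
  exact hx0 (congrArg Prod.fst h4)

/-- The second order coefficient of the curve of fibrewise critical points. -/
noncomputable def sectionCoeff (V : (Fin 4 → ℝ) → ℝ) (P : Fin 4 → ℝ) : Fin 3 → ℝ :=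
  (hessianXYZ V P)⁻¹.mulVec (κ V P)

theorem mulVec_sectionCoeff (hdet : (hessianXYZ V P).det ≠ 0) :
    (hessianXYZ V P).mulVec (sectionCoeff V P) = κ V P := by
  rw [sectionCoeff, Matrix.mulVec_mulVec, Matrix.mul_nonsing_inv _ hdet.isUnit,
    Matrix.one_mulVec]

theorem det_mul_dotProduct_sectionCoeff (hdet : (hessianXYZ V P).det ≠ 0) :
    (hessianXYZ V P).det * (sectionCoeff V P ⬝ᵥ κ V P) =
      ∑ i : Fin 3, ∑ j : Fin 3,
        (-1) ^ ((i : ℕ) + (j : ℕ)) * minorXYZ V P i j * κ V P i * κ V P j := by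
  have h1 : (hessianXYZ V P).det • sectionCoeff V P = (hessianXYZ V P).adjugate.mulVec (κ V P) := by
    rw [sectionCoeff, Matrix.inv_def, Ring.inverse_eq_inv', Matrix.smul_mulVec, smul_smul,
      mul_inv_cancel₀ hdet, one_smul]
  rw [← smul_eq_mul, ← smul_dotProduct, h1, dotProduct]
  simp only [Matrix.mulVec, dotProduct, Finset.sum_mul,
    Matrix.adjugate_fin_succ_eq_det_submatrix, minorXYZ]
  rw [Finset.sum_comm]

theorem HasCorankOneZW.kernel (hV : IsSmoothGerm V P) (h : HasCorankOneZW V P)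
    (hz : pd 2 (pd 2 V) P ≠ 0) :
    fderiv ℝ (fderiv ℝ V) P (shearCoords (α V P) (0, 1)) = 0 := by
  ext y
  rw [fderiv_fderiv_symm hV, fderiv_fderiv_eq_dotProduct hV, h.mulVec_shearCoords hz,
    dotProduct_zero]
  rfl

theorem dirDeriv_snd_snd_fst (hV : IsSmoothGerm V P) (y : Fin 3 → ℝ) :
    dirDeriv (shearCoords (α V P) (0, 1)) (dirDeriv (shearCoords (α V P) (0, 1))
      (dirDeriv (shearCoords (α V P) (y, 0)) V)) P = y ⬝ᵥ κ V P := by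
  rw [← dirDeriv_fst_snd_snd hV]
  exact ((dirDeriv_congr _ (dirDeriv_comm _ _ hV)).trans
    (dirDeriv_comm _ _ (hV.fderiv_apply _))).self_of_nhds

theorem dirDeriv_fst_fst (hV : IsSmoothGerm V P) (x y : Fin 3 → ℝ) :
    dirDeriv (shearCoords (α V P) (x, 0)) (dirDeriv (shearCoords (α V P) (y, 0)) V) P =
      x ⬝ᵥ (hessianXYZ V P).mulVec y := by
  rw [dirDeriv, ← fderiv_fderiv_apply hV, fderiv_fderiv_eq_dotProduct hV, dotProduct_shear_fst]

theorem HasCorankOneZW.exists_isAdapted (hV : IsSmoothGerm V P) (hcrit : fderiv ℝ V P = 0)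
    (h : HasCorankOneZW V P) (hz : pd 2 (pd 2 V) P ≠ 0) :
    ∃ A, IsAdapted (shearCoords (α V P)) A (sectionCoeff V P) V P := by
  have hdet := h.det_hessianXYZ_ne_zero hV hz
  let ι : (Fin 3 → ℝ) →L[ℝ] (Fin 4 → ℝ) :=
    (shearCoords (α V P) : (Fin 3 → ℝ) × ℝ →L[ℝ] (Fin 4 → ℝ)).comp
      (ContinuousLinearMap.inl ℝ (Fin 3 → ℝ) ℝ)
  let B := (fderiv ℝ (fderiv ℝ V) P).bilinearComp ι ι
  have hB : ∀ x y, B x y = x ⬝ᵥ (hessianXYZ V P).mulVec y := fun x y => by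
    rw [← dotProduct_shear_fst (α V P), ← fderiv_fderiv_eq_dotProduct hV]
    rfl
  have hinj : Function.Injective B := by
    refine (injective_iff_map_eq_zero B).2 fun x hx => ?_
    have h1 : (hessianXYZ V P).mulVec x = 0 := by
      refine dotProduct_eq_zero _ fun y => ?_
      have h2 : B x y = 0 := by rw [hx]; rfl
      rw [hB, Matrix.dotProduct_mulVec, ← Matrix.mulVec_transpose, hessianXYZ_isSymm hV] at h2
      exact h2
    exact Matrix.eq_zero_of_mulVec_eq_zero hdet h1
  obtain ⟨A, hA⟩ := exists_continuousLinearEquiv_dual hinj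
  refine ⟨A, hV, hcrit, h.kernel hV hz, fun x y => ?_, fun y => ?_⟩
  · rw [hA]
    rfl
  -- The second-order coefficient is half of `y · κ - y · (hessianXYZ V P) a`, which vanishes by the
  -- choice of `a`.
  · have h1 := dirDeriv_snd_snd_fst hV y
    have h2 := dirDeriv_fst_fst hV (sectionCoeff V P) y
    rw [Matrix.dotProduct_mulVec, ← Matrix.mulVec_transpose, hessianXYZ_isSymm hV,
      mulVec_sectionCoeff hdet, dotProduct_comm] at h2
    simp only [dirDeriv] at h1 h2
    rw [curveCoeff, curveCoeff, curveCoeff, h1, h2, sub_self, zero_div]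

theorem HasCorankOneZW.curveCoeff_two (hV : IsSmoothGerm V P) (hcrit : fderiv ℝ V P = 0)
    (h : HasCorankOneZW V P) (hz : pd 2 (pd 2 V) P ≠ 0) (a : Fin 4 → ℝ) :
    curveCoeff (shearCoords (α V P) (0, 1)) a P 2 V = 0 := by
  rw [curveCoeff, curveCoeff, curveCoeff, ← fderiv_fderiv_apply hV, h.kernel hV hz, hcrit]
  simp

theorem HasCorankOneZW.curveCoeff_three (hV : IsSmoothGerm V P) (h : HasCorankOneZW V P)
    (hz : pd 2 (pd 2 V) P ≠ 0) (a : Fin 4 → ℝ) :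
    curveCoeff (shearCoords (α V P) (0, 1)) a P 3 V = -D3 V P / 6 := by
  have h1 := dirDeriv_three_eq hV
  simp only [dirDeriv] at h1
  rw [curveCoeff, curveCoeff, curveCoeff, curveCoeff, curveCoeff, h1,
    ← fderiv_fderiv_apply hV a, ← fderiv_fderiv_apply hV _ a, fderiv_fderiv_symm hV a,
    h.kernel hV hz]
  simp
  ring

/-- Unfolding the recursion gives `(D⁴V - 3 a · κ) / 24`: the mixed derivatives in `v, v, a` and the
derivative in `a, a` all equal `a · κ`. Cramer's rule turns `M (a · κ)` into the sum over minors. -/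
theorem HasCorankOneZW.curveCoeff_four (hV : IsSmoothGerm V P) (h : HasCorankOneZW V P)
    (hz : pd 2 (pd 2 V) P ≠ 0) :
    24 * (hessianXYZ V P).det * curveCoeff (shearCoords (α V P) (0, 1))
      (shearCoords (α V P) (sectionCoeff V P, 0)) P 4 V = quarticForm V P := by
  have hdet := h.det_hessianXYZ_ne_zero hV hz
  have h1 := dirDeriv_shear_four hV (α V P)
  rw [← D4] at h1
  have h2 := dirDeriv_fst_snd_snd hV (sectionCoeff V P)
  have h3 := dirDeriv_snd_snd_fst hV (sectionCoeff V P)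
  have h4 := dirDeriv_fst_fst hV (sectionCoeff V P) (sectionCoeff V P)
  rw [mulVec_sectionCoeff hdet] at h4
  have h5 : dirDeriv (shearCoords (α V P) (0, 1))
      (dirDeriv (shearCoords (α V P) (sectionCoeff V P, 0))
        (dirDeriv (shearCoords (α V P) (0, 1)) V)) P = sectionCoeff V P ⬝ᵥ κ V P := by
    rw [← h2]
    exact (dirDeriv_comm _ _ (hV.fderiv_apply _)).self_of_nhds
  simp only [dirDeriv] at h1 h2 h3 h4 h5
  rw [quarticForm, ← det_mul_dotProduct_sectionCoeff hdet]
  simp only [curveCoeff, h1, h2, h3, h4, h5]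
  push_cast
  ring

end CorankOne

/-! ### Determinants and the criterion for 2-determinacy -/

theorem injective_fderiv_fderiv_iff {V : (Fin 4 → ℝ) → ℝ} {P : Fin 4 → ℝ}
    (hV : IsSmoothGerm V P) :
    Function.Injective (fderiv ℝ (fderiv ℝ V) P) ↔ (hessian V P).det ≠ 0 := by
  have key : ∀ x, fderiv ℝ (fderiv ℝ V) P x = 0 ↔ (hessian V P).mulVec x = 0 := fun x => by
    constructor
    · intro hx
      refine dotProduct_eq_zero _ fun y => ?_
      rw [dotProduct_comm, ← fderiv_fderiv_eq_dotProduct hV, fderiv_fderiv_symm hV, hx]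
      rfl
    · intro hx
      ext y
      rw [fderiv_fderiv_symm hV, fderiv_fderiv_eq_dotProduct hV, hx, dotProduct_zero]
      rfl
  rw [injective_iff_map_eq_zero, ne_eq, ← Matrix.exists_mulVec_eq_zero_iff]
  simp only [key]
  push Not
  exact forall_congr' fun x => ⟨fun h h0 h1 => h0 (h h1), fun h h1 => by_contra fun h0 => h h0 h1⟩

theorem not_isDetermined_two_iff {V : (Fin 4 → ℝ) → ℝ} {P : Fin 4 → ℝ} (hV : IsSmoothGerm V P)
    (hcrit : fderiv ℝ V P = 0) : ¬ IsDetermined 2 V P ↔ (hessian V P).det = 0 := by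
  constructor
  · intro h
    by_contra hdet
    exact h (isDetermined_two_of_nondegenerate hV hcrit ((injective_fderiv_fderiv_iff hV).2 hdet))
  · intro hdet
    have h1 : ¬ Function.Injective (fderiv ℝ (fderiv ℝ V) P) := fun h =>
      (injective_fderiv_fderiv_iff hV).1 h hdet
    rw [injective_iff_map_eq_zero] at h1
    push Not at h1
    obtain ⟨v, hv, hv0⟩ := h1
    exact not_isDetermined_two_of_degenerate hV hcrit hv0 hv

theorem det_hessianZW_eq {V : (Fin 4 → ℝ) → ℝ} {P : Fin 4 → ℝ} (hV : IsSmoothGerm V P)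
    (hz : pd 2 (pd 2 V) P ≠ 0) : (hessianZW V P).det = pd 2 (pd 2 V) P * D2 V P := by
  have h1 : pd 3 (pd 2 V) P = pd 2 (pd 3 V) P := hessian_symm hV 3 2
  rw [Matrix.det_fin_two, D2, α]
  simp only [hessianZW, hessian, Matrix.submatrix_apply, Matrix.of_apply, Matrix.cons_val_zero,
    Matrix.cons_val_one, h1]
  field_simp
  ring

end Determinacy

open Determinacy

theorem mainTheorem1 (V : (Fin 4 → ℝ) → ℝ) (P : Fin 4 → ℝ)
    (hV : Determinacy.IsSmoothGerm V P) (hcrit : fderiv ℝ V P = 0) :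
    (¬ Determinacy.IsDetermined 2 V P ↔ (Determinacy.hessian V P).det = 0) ∧
    (Determinacy.pd 2 (Determinacy.pd 2 V) P ≠ 0 →
      (Determinacy.HasCorankOneZW V P ∨ (Determinacy.hessian V P).PosDef) →
      ((Determinacy.hessian V P).det = 0 ↔ (Determinacy.hessianZW V P).det = 0) ∧
      (¬ Determinacy.IsDetermined 2 V P ↔ Determinacy.D2 V P = 0) ∧
      (¬ Determinacy.IsDetermined 3 V P ↔
        Determinacy.D2 V P = 0 ∧ Determinacy.D3 V P = 0) ∧
      (¬ Determinacy.IsDetermined 4 V P ↔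
        Determinacy.D2 V P = 0 ∧ Determinacy.D3 V P = 0 ∧
          Determinacy.quarticForm V P = 0)) := by
  have h2 := not_isDetermined_two_iff hV hcrit
  refine ⟨h2, fun hz hcase => ?_⟩
  have hZW : (hessianZW V P).det = 0 ↔ D2 V P = 0 := by
    rw [det_hessianZW_eq hV hz, mul_eq_zero, or_iff_right hz]
  rw [h2, hZW]
  rcases hcase with h | h
  · have hdet : (hessian V P).det = 0 := by
      refine Matrix.exists_mulVec_eq_zero_iff.1 ⟨_, fun h0 => ?_, h.mulVec_shearCoords hz⟩
      simpa [shearCoords_apply] using congrFun h0 3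
    have hD2 : D2 V P = 0 := by
      have h3 := (dirDeriv_dirDeriv_shear hV (α V P)).self_of_nhds
      have h4 : dirDeriv (shearCoords (α V P) (0, 1))
          (dirDeriv (shearCoords (α V P) (0, 1)) V) P = 0 := by
        rw [dirDeriv, ← fderiv_fderiv_apply hV, h.kernel hV hz]
        rfl
      rw [h4] at h3
      rw [D2]
      linarith
    obtain ⟨A, hA⟩ := h.exists_isAdapted hV hcrit hz
    have hM := h.det_hessianXYZ_ne_zero hV hz
    set a := shearCoords (α V P) (sectionCoeff V P, 0)
    have hC1 : curveCoeff (shearCoords (α V P) (0, 1)) a P 1 V = 0 := by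
      rw [curveCoeff, hcrit]
      rfl
    have hC2 := h.curveCoeff_two hV hcrit hz a
    have hC3 := h.curveCoeff_three hV hz a
    have hC4 := h.curveCoeff_four hV hz
    have hC3' : curveCoeff (shearCoords (α V P) (0, 1)) a P 3 V = 0 ↔ D3 V P = 0 := by
      rw [hC3]
      simp
    have hC4' : curveCoeff (shearCoords (α V P) (0, 1)) a P 4 V = 0 ↔ quarticForm V P = 0 := by
      rw [← hC4]
      simp [hM, a]
    have hdet3 : D3 V P ≠ 0 → IsDetermined 3 V P := fun h3 => by
      refine hA.isDetermined le_rfl (by norm_num) (fun i h0 hi => ?_) (fun h4 => h3 (hC3'.1 h4))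
      interval_cases i
      exacts [hC1, hC2]
    refine ⟨by simp [hdet, hD2], by simp [hdet, hD2], ⟨fun hnd => ⟨hD2, ?_⟩, ?_⟩,
      ⟨fun hnd => ⟨hD2, ?_⟩, ?_⟩⟩
    · by_contra h3
      exact hnd (hdet3 h3)
    · rintro ⟨-, h3⟩
      refine hA.not_isDetermined (by norm_num) fun i h0 hi => ?_
      interval_cases i
      exacts [hC1, hC2, hC3'.2 h3]
    -- A 3-determined germ is 4-determined, so failure of 4-determinacy already forces the cubic
    -- coefficient to vanish.
    · have h3 : D3 V P = 0 := by
        by_contra h3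
        exact hnd ((hdet3 h3).mono (by norm_num))
      refine ⟨h3, ?_⟩
      by_contra h4
      refine hnd (hA.isDetermined (by norm_num) (by norm_num) (fun i h0 hi => ?_)
        (fun h5 => h4 (hC4'.1 h5)))
      interval_cases i
      exacts [hC1, hC2, hC3'.2 h3]
    · rintro ⟨-, h3, h4⟩
      refine hA.not_isDetermined (by norm_num) fun i h0 hi => ?_
      interval_cases i
      exacts [hC1, hC2, hC3'.2 h3, hC4'.2 h4]
  -- For a positive definite Hessian both determinants are positive and both sides of every
  -- equivalence are false.
  · have hdet : (hessian V P).det ≠ 0 := h.det_pos.ne'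
    have hZWdet : (hessianZW V P).det ≠ 0 :=
      (h.submatrix (e := ![2, 3]) (by decide)).det_pos.ne'
    have hD2 : D2 V P ≠ 0 := fun h0 => hZWdet (hZW.2 h0)
    have hd2 : IsDetermined 2 V P := not_not.1 fun h0 => hdet (h2.1 h0)
    have hd3 : IsDetermined 3 V P := hd2.mono (by norm_num)
    have hd4 : IsDetermined 4 V P := hd2.mono (by norm_num)
    simp [hdet, hD2, hd3, hd4]
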